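/- Theorem. For a finite tree $T=(V,E)$ with $n$ vertices, a hub labeling is a family $(H_u)_{u\in V}$ of subsets of $V$ such that for all $u,v\in V$ (possibly $u=v$) some vertex of $H_u\cap H_v$ lies on the (shortest) path between $u$ and $v$. The problem $\mathrm{HL}_1$ asks for a hub labeling that minimizes the cost $\sum_{u\in V}|H_u|$. A subtree $T'$ of $T$ is a nonempty connected set of vertices, with boundary $\partial(T')=\{v\in V\setminus T' : v \text{ has a neighbour in } T'\}$. For an integer $k\ge 0$ let $B_k[T']=\infty$ if $|\partial(T')|>k$, and otherwise $$B_k[T'] = |T'| + \min_{r\in T'}\ \sum_{T''\text{ a connected component of }T'-r} B_k[T''].$$ There are constants $c$, $C$ and a single algorithm with the following property. Given any tree $T$ with $n\ge 1$ vertices (by its adjacency matrix), put $k=c\lfloor\log_2 n\rfloor$; within $C\cdot n^{C\lfloor \log_2 n\rfloor}=n^{O(\log n)}$ steps the algorithm outputs the dynamic programming table consisting of the values $B_k[T']$ for all subtrees $T'$ of $T$ with $|\partial(T')|\le k$, together with an optimal solution $(H_u)_{u\in V}$ of $\mathrm{HL}_1$ on $T$; moreover $B_k[T]=\sum_{u\in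 V}|H_u|$ is the optimal cost. Here an algorithm is a program in a first-order functional language whose values are binary trees (S-expressions), with numbers in unary, vertex sets given by characteristic vectors, and one step charged for the evaluation of each variable, constant nil, cons, head, tail, conditional, local binding and function call; each of these takes $O(1)$ time on a pointer machine or RAM. -/

import Mathlib

namespace HubLabeling

section Graphs

variable {V : Type*}

/-- A hub labeling of `G` (unit edge lengths): any two vertices `u`, `v`, not necessarily distinct,
have a common hub that lies on a shortest path between them. -/
def IsHubLabeling (G : SimpleGraph V) (H : V → Finset V) : Prop :=
  ∀ u v : V, ∃ w ∈ H u, w ∈ H v ∧ ∃ p : G.Walk u v, p.length = G.dist u v ∧ w ∈ p.support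

/-- The `ℓ₁`-cost of a labeling. -/
def cost [Fintype V] (H : V → Finset V) : ℕ :=
  ∑ u, (H u).card

/-- An optimal solution of the hub labeling problem with the `ℓ₁`-cost. -/
def IsOptimal [Fintype V] (G : SimpleGraph V) (H : V → Finset V) : Prop :=
  IsHubLabeling G H ∧ ∀ H' : V → Finset V, IsHubLabeling G H' → cost H ≤ cost H'

/-- `S` is the vertex set of a (nonempty) subtree of the tree `G`. -/
def IsSubtree (G : SimpleGraph V) (S : Finset V) : Prop :=
  (G.induce (S : Set V)).Connected

open Classical in
/-- The boundary of `S`: the vertices outside `S` that have a neighbour in `S`. -/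
noncomputable def boundary [Fintype V] (G : SimpleGraph V) (S : Finset V) : Finset V :=
  {v | v ∉ S ∧ ∃ u ∈ S, G.Adj u v}

open Classical in
/-- The vertex sets of the connected components of the subgraph induced by `A`. -/
noncomputable def components (G : SimpleGraph V) (A : Finset V) : Finset (Finset V) :=
  {C ∈ A.powerset | Maximal (fun D : Finset V => D ⊆ A ∧ (G.induce (D : Set V)).Connected) C}

theorem subset_of_mem_components {G : SimpleGraph V} {A C : Finset V}
    (h : C ∈ components G A) : C ⊆ A := by
  classical
  exact Finset.mem_powerset.mp (Finset.mem_filter.mp h).1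

open Classical in
/-- The dynamic program over subtrees, restricted to boundaries of size at most `k`:
`B[S] = ∞` if `|∂S| > k`, and otherwise
`B[S] = |S| + min_{r ∈ S} ∑ B[C]`, the sum being over the components `C` of `S - r`. -/
noncomputable def dp [Fintype V] (G : SimpleGraph V) (k : ℕ) (S : Finset V) : ℕ∞ :=
  if (boundary G S).card ≤ k then
    (S.card : ℕ∞) + ⨅ r : {r // r ∈ S},
      ∑ C : {C // C ∈ components G (S.erase r.1)}, dp G k C.1
  else ⊤
termination_by S.card
decreasing_by
  exact lt_of_le_of_lt (Finset.card_le_card (subset_of_mem_components C.2))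
    (Finset.card_erase_lt_of_mem r.2)

end Graphs

/-! A first-order functional language on binary trees. Every construct corresponds to boundedly
many steps of a pointer machine or of a RAM, and is charged one step. -/

/-- Values: binary trees (S-expressions with the single atom `nil`). -/
inductive Data where
  | nil : Data
  | cons : Data → Data → Data

def Data.head : Data → Data
  | .nil => .nil
  | .cons a _ => a

def Data.tail : Data → Data
  | .nil => .nil
  | .cons _ b => b

/-- Terms. `var i` is the `i`-th entry of the environment, `ite c a b` branches on whether the value
of `c` is a `cons`, `bind e b` evaluates `b` with the value of `e` put in front of the environment,
and `call f e` calls the function number `f` of the program on the value of `e`. -/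
inductive Term where
  | var : ℕ → Term
  | nil : Term
  | cons : Term → Term → Term
  | head : Term → Term
  | tail : Term → Term
  | ite : Term → Term → Term → Term
  | bind : Term → Term → Term
  | call : ℕ → Term → Term

/-- A program is a finite list of (mutually recursive) functions of one argument, given by their
bodies. -/
abbrev Program := List Term

/-- `Eval P env e v t`: in the environment `env`, call-by-value evaluation of `e` terminates with
the value `v` after `t` steps. -/
inductive Eval (P : Program) : List Data → Term → Data → ℕ → Prop
  | var {env : List Data} {i : ℕ} {v : Data} (h : env[i]? = some v) : Eval P env (.var i) v 1
  | nil {env : List Data} : Eval P env .nil .nil 1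
  | cons {env : List Data} {a b : Term} {x y : Data} {s t : ℕ}
      (ha : Eval P env a x s) (hb : Eval P env b y t) :
      Eval P env (.cons a b) (.cons x y) (s + t + 1)
  | head {env : List Data} {e : Term} {x : Data} {t : ℕ} (h : Eval P env e x t) :
      Eval P env (.head e) x.head (t + 1)
  | tail {env : List Data} {e : Term} {x : Data} {t : ℕ} (h : Eval P env e x t) :
      Eval P env (.tail e) x.tail (t + 1)
  | ite_cons {env : List Data} {c a b : Term} {x y v : Data} {s t : ℕ}
      (hc : Eval P env c (.cons x y) s) (ha : Eval P env a v t) :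
      Eval P env (.ite c a b) v (s + t + 1)
  | ite_nil {env : List Data} {c a b : Term} {v : Data} {s t : ℕ}
      (hc : Eval P env c .nil s) (hb : Eval P env b v t) :
      Eval P env (.ite c a b) v (s + t + 1)
  | bind {env : List Data} {e b : Term} {x v : Data} {s t : ℕ}
      (he : Eval P env e x s) (hb : Eval P (x :: env) b v t) :
      Eval P env (.bind e b) v (s + t + 1)
  | call {env : List Data} {f : ℕ} {e body : Term} {x v : Data} {s t : ℕ}
      (he : Eval P env e x s) (hf : P[f]? = some body) (hb : Eval P [x] body v t) :
      Eval P env (.call f e) v (s + t + 1)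

/-- Evaluation is deterministic, so a program has at most one output and one running time on each
input. -/
theorem Eval.unique {P : Program} {env : List Data} {e : Term} {v : Data} {t : ℕ}
    (h : Eval P env e v t) : ∀ {v' : Data} {t' : ℕ}, Eval P env e v' t' → v = v' ∧ t = t' := by
  induction h with
  | var h => intro v' t' h'; cases h' with | var h2 => simp_all
  | nil => intro v' t' h'; cases h'; simp
  | cons _ _ iha ihb =>
    intro v' t' h'
    cases h' with | cons h1 h2 => have := iha h1; have := ihb h2; simp_all
  | head _ ih => intro v' t' h'; cases h' with | head h1 => have := ih h1; simp_all
  | tail _ ih => intro v' t' h'; cases h' with | tail h1 => have := ih h1; simp_all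
  | ite_cons _ _ ihc iha =>
    intro v' t' h'
    cases h' with
    | ite_cons h1 h2 => have := ihc h1; have := iha h2; simp_all
    | ite_nil h1 h2 => have := ihc h1; simp_all
  | ite_nil _ _ ihc ihb =>
    intro v' t' h'
    cases h' with
    | ite_cons h1 h2 => have := ihc h1; simp_all
    | ite_nil h1 h2 => have := ihc h1; have := ihb h2; simp_all
  | bind _ _ ihe ihb =>
    intro v' t' h'
    cases h' with
    | bind h1 h2 =>
      obtain ⟨rfl, rfl⟩ := ihe h1
      obtain ⟨rfl, rfl⟩ := ihb h2
      simp
  | call _ hf _ ihe ihb =>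
    intro v' t' h'
    cases h' with
    | call h1 hf' h2 =>
      obtain ⟨rfl, rfl⟩ := ihe h1
      obtain rfl := Option.some.inj (hf.symm.trans hf')
      obtain ⟨rfl, rfl⟩ := ihb h2
      simp

/-- On the given input, the program (whose main function is its first one) halts with the given
output after exactly `t` steps. -/
def Program.Runs (P : Program) (input output : Data) (t : ℕ) : Prop :=
  Eval P [input] (.call 0 (.var 0)) output t

section Encodings

/-- Natural numbers are written in unary. -/
def encNat : ℕ → Data
  | 0 => .nil
  | m + 1 => .cons .nil (encNat m)

def encBool : Bool → Data
  | false => .nil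
  | true => .cons .nil .nil

def encList {α : Type*} (enc : α → Data) : List α → Data
  | [] => .nil
  | a :: l => .cons (enc a) (encList enc l)

open Classical in
/-- `∞` is `nil`, a finite value `m` is a `cons` that carries the numeral of `m`. -/
noncomputable def encENat (b : ℕ∞) : Data :=
  if b = ⊤ then .nil else .cons .nil (encNat b.toNat)

/-- A set of vertices is given by its characteristic vector. -/
def encSet {n : ℕ} (S : Finset (Fin n)) : Data :=
  encList encBool (List.ofFn fun i : Fin n => decide (i ∈ S))

/-- A family of vertex sets, indexed by the vertices, is given row by row. -/
def encFamily {n : ℕ} (H : Fin n → Finset (Fin n)) : Data :=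
  encList encSet (List.ofFn H)

open Classical in
/-- A graph is given by its adjacency matrix. -/
noncomputable def encGraph {n : ℕ} (G : SimpleGraph (Fin n)) : Data :=
  encFamily fun i : Fin n => {j : Fin n | G.Adj i j}

/-- A table is given as the list of its entries, each a pair of a vertex set and a value. -/
noncomputable def encTable {n : ℕ} (L : List (Finset (Fin n) × ℕ∞)) : Data :=
  encList (fun e => .cons (encSet e.1) (encENat e.2)) L

end Encodings

/-- `L` is the table of the dynamic program with boundary bound `k`: it has exactly one entry
`(S, B[S])` for each subtree `S` with `|∂S| ≤ k`, and no other entries. -/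
def IsTable {n : ℕ} (G : SimpleGraph (Fin n)) (k : ℕ) (L : List (Finset (Fin n) × ℕ∞)) : Prop :=
  L.Nodup ∧ ∀ (S : Finset (Fin n)) (b : ℕ∞),
    (S, b) ∈ L ↔ IsSubtree G S ∧ (boundary G S).card ≤ k ∧ b = dp G k S

end HubLabeling

/-!
Removing a vertex `r` from a subtree `S` and adding `r` to the labels of all vertices of `S` reduces
the labeling problem on `S` to the components of `S - r`, so the dynamic program without boundary
bound (`opt`) is the cost of some labeling (`exists_isOptLabels`). Conversely it bounds the cost of
every labeling from below (`Labels.opt_le`): the subtrees spanned by the hubs of the single vertices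
intersect pairwise, hence have a common vertex `r` (`Labels.exists_root`), and so every vertex has
a hub at or beyond `r`. These hubs pay for adding `r` to all labels, and the remaining hubs inside
the components of `S - r` label these components.

A boundary bound of order `log n` is harmless because optimal recursions have logarithmic depth
(`Chain.card_le_log`). Let `R` be the roots chosen on the way from `S` down to a subtree `D`; some
optimal labeling of `S` has all of `R` in the labels of all vertices of `D`. Moving a centroid `c` of
`S` to the top of the labels costs at most `|S|` and makes every pair of a vertex and a hub beyond
`c` superfluous. If `D` has more than half of the vertices of `S`, each root in `R` contributes at
least `|D| - |S| / 2` such pairs, so optimality gives `|R| (|D| - |S| / 2) ≤ |S|`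
(`Chain.card_mul_le`). Therefore ten steps halve the size, and the boundary of a subtree reached by
an optimal recursion consists of earlier roots (`dp_log_univ`).

The algorithm lists all sets that miss at most `k` vertices; their components are exactly the
subtrees with a boundary of size at most `k` (`mem_subtrees`). It then recomputes all entries of the
table `n` times, after which every entry is final (`costOf_entry`). An entry is a labeling, given as
a list of pairs, whose length is its cost; the entry of the whole tree provides the optimal solution.

For the running time, `PolyTime` is the class of functions between encoded types that terms of the
language compute in polynomial time with results of polynomial size. It is closed under composition,
case distinction, and recursion on lists as long as the intermediate results have polynomial size
(`PolyTime.foldr`). Every phase of the algorithm is of this kind apart from the list of sets, which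
has `n ^ O(log n)` members (`computes_prepared`); the later phases are polynomial in its size.
-/

namespace HubLabeling

set_option linter.unusedSectionVars false

/-! ### Betweenness in a tree -/

section TreeMetric

variable {V : Type*} {G : SimpleGraph V}

/-- The vertex `w` lies on a shortest path between `u` and `v`. -/
def Btw (G : SimpleGraph V) (u w v : V) : Prop :=
  G.dist u w + G.dist w v = G.dist u v

noncomputable instance (u w v : V) : Decidable (Btw G u w v) :=
  Nat.decEq _ _

theorem Btw.symm {u w v : V} (h : Btw G u w v) : Btw G v w u := by
  unfold Btw at *
  rw [G.dist_comm (u := v) (v := w), G.dist_comm (u := w) (v := u), G.dist_comm (u := v) (v := u)]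
  omega

theorem btw_left (u v : V) : Btw G u u v := by simp [Btw]

theorem btw_right (u v : V) : Btw G u v v := by simp [Btw]

theorem Btw.eq_of_self (hG : G.Connected) {u w : V} (h : Btw G u w u) : w = u := by
  simp only [Btw, SimpleGraph.dist_self, Nat.add_eq_zero_iff] at h
  exact (hG.dist_eq_zero_iff.mp h.1).symm

theorem Btw.trans (hG : G.Connected) {u w v x : V} (h : Btw G u w v) (h' : Btw G u x w) :
    Btw G u x v := by
  unfold Btw at *
  have h1 := hG.dist_triangle (u := u) (v := x) (w := v)
  have h2 := hG.dist_triangle (u := x) (v := w) (w := v)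
  omega

theorem btw_iff_exists_walk (hG : G.Connected) {u w v : V} :
    Btw G u w v ↔ ∃ p : G.Walk u v, p.length = G.dist u v ∧ w ∈ p.support := by
  constructor
  · intro h
    obtain ⟨p, hp⟩ := hG.exists_walk_length_eq_dist u w
    obtain ⟨q, hq⟩ := hG.exists_walk_length_eq_dist w v
    refine ⟨p.append q, ?_, ?_⟩
    · rw [SimpleGraph.Walk.length_append, hp, hq]; exact h
    · simp
  · rintro ⟨p, hp, hw⟩
    classical
    have h1 := SimpleGraph.dist_le (p.takeUntil w hw)
    have h2 := SimpleGraph.dist_le (p.dropUntil w hw)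
    have h3 := congrArg SimpleGraph.Walk.length (p.take_spec hw)
    rw [SimpleGraph.Walk.length_append] at h3
    have h4 := hG.dist_triangle (u := u) (v := w) (w := v)
    unfold Btw
    omega

/-- In a tree, every walk from `u` to `v` visits all the vertices between `u` and `v`. -/
theorem mem_support_of_btw (hG : G.IsTree) {u w v : V} (h : Btw G u w v) (p : G.Walk u v) :
    w ∈ p.support := by
  classical
  obtain ⟨q, hq, hw⟩ := (btw_iff_exists_walk hG.connected).mp h
  have hqp := q.isPath_of_length_eq_dist hq
  have := (hG.isAcyclic.subsingleton_path u v).elim ⟨q, hqp⟩ ⟨p.bypass, p.bypass_isPath⟩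
  have h2 : q = p.bypass := congrArg Subtype.val this
  exact p.support_bypass_subset_support (h2 ▸ hw)

/-- Trees are `0`-hyperbolic: each side of a geodesic triangle is covered by the other two. -/
theorem Btw.cases (hG : G.IsTree) {u x w : V} (h : Btw G u x w) (v : V) :
    Btw G u x v ∨ Btw G v x w := by
  obtain ⟨p, hp⟩ := hG.connected.exists_walk_length_eq_dist u v
  obtain ⟨q, hq⟩ := hG.connected.exists_walk_length_eq_dist v w
  have := mem_support_of_btw hG h (p.append q)
  rw [SimpleGraph.Walk.mem_support_append_iff] at this
  exact this.imp (fun h => (btw_iff_exists_walk hG.connected).mpr ⟨p, hp, h⟩)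
    (fun h => (btw_iff_exists_walk hG.connected).mpr ⟨q, hq, h⟩)

/-- The neighbour of `x` on the way to `u`. -/
theorem exists_adj_btw (hG : G.Connected) {x u : V} (h : x ≠ u) :
    ∃ y, G.Adj x y ∧ Btw G x y u := by
  obtain ⟨p, hp⟩ := hG.exists_walk_length_eq_dist x u
  cases p with
  | nil => exact absurd rfl h
  | @cons _ y _ hxy q =>
    refine ⟨y, hxy, (btw_iff_exists_walk hG).mpr ⟨_, hp, ?_⟩⟩
    simp

theorem Btw.of_adj_of_adj (hG : G.IsTree) {x y u v : V} (hxy : G.Adj x y)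
    (hu : G.dist u x = G.dist u y + 1) (hv : G.dist v y = G.dist v x + 1) : Btw G u y v := by
  have h1 : Btw G u y x := by
    unfold Btw; rw [SimpleGraph.dist_eq_one_iff_adj.mpr hxy.symm]; omega
  rcases h1.cases hG v with h | h
  · exact h
  · unfold Btw at h; omega

/-- The neighbour of `y` that is closer to the vertex `ρ` is unique. -/
theorem eq_of_adj_of_closer (hG : G.IsTree) {ρ x x' y : V} (hx : G.Adj x y) (hx' : G.Adj x' y)
    (h : G.dist ρ y = G.dist ρ x + 1) (h' : G.dist ρ y = G.dist ρ x' + 1) : x = x' := by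
  have h1 : Btw G ρ x y := by
    unfold Btw; rw [SimpleGraph.dist_eq_one_iff_adj.mpr hx]; omega
  have e1 := SimpleGraph.dist_eq_one_iff_adj.mpr hx
  have e2 := SimpleGraph.dist_eq_one_iff_adj.mpr hx'
  rw [← hG.connected.dist_eq_zero_iff]
  rcases h1.cases hG x' with h2 | h2 <;> unfold Btw at h2
  · omega
  · rw [G.dist_comm] at h2; omega

/-! ### Subtrees and components -/

/-- The set `S` contains all the vertices between any two of its members. -/
def GConvex (G : SimpleGraph V) (S : Finset V) : Prop :=
  ∀ u ∈ S, ∀ v ∈ S, ∀ w, Btw G u w v → w ∈ S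

theorem isSubtree_iff (hG : G.IsTree) {S : Finset V} :
    IsSubtree G S ↔ S.Nonempty ∧ GConvex G S := by
  constructor
  · intro h
    refine ⟨?_, fun u hu v hv w hw => ?_⟩
    · obtain ⟨x⟩ := h.nonempty
      exact ⟨x.1, x.2⟩
    · obtain ⟨p⟩ := h.preconnected ⟨u, hu⟩ ⟨v, hv⟩
      have h1 := mem_support_of_btw hG hw (p.map (SimpleGraph.Embedding.induce _).toHom)
      have h2 := SimpleGraph.Walk.support_map (SimpleGraph.Embedding.induce (S : Set V)).toHom p
      obtain ⟨y, -, rfl⟩ := List.mem_map.mp (h2 ▸ h1)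
      exact y.2
  · rintro ⟨⟨x, hx⟩, hc⟩
    have : Nonempty (S : Set V) := ⟨⟨x, hx⟩⟩
    refine ⟨fun u v => ?_⟩
    obtain ⟨p, hp⟩ := hG.connected.exists_walk_length_eq_dist u.1 v.1
    exact ⟨p.induce _ fun w hw => hc u u.2 v v.2 w
      ((btw_iff_exists_walk hG.connected).mpr ⟨p, hp, hw⟩)⟩

open Classical in
/-- The component of `v` in the subgraph induced by `A` (empty if `v ∉ A`). -/
noncomputable def compOf (G : SimpleGraph V) (A : Finset V) (v : V) : Finset V :=
  {w ∈ A | ∀ x, Btw G v x w → x ∈ A}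

theorem mem_compOf {A : Finset V} {v w : V} :
    w ∈ compOf G A v ↔ ∀ x, Btw G v x w → x ∈ A := by
  simp only [compOf, Finset.mem_filter, and_iff_right_iff_imp]
  exact fun h => h w (btw_right v w)

theorem compOf_subset (A : Finset V) (v : V) : compOf G A v ⊆ A := by
  classical
  exact Finset.filter_subset _ _

theorem self_mem_compOf (hG : G.Connected) {A : Finset V} {v : V} (hv : v ∈ A) :
    v ∈ compOf G A v := by
  rw [mem_compOf]
  intro x hx
  exact hx.eq_of_self hG ▸ hv

theorem mem_of_mem_compOf {A : Finset V} {v w : V} (h : w ∈ compOf G A v) : v ∈ A :=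
  mem_compOf.mp h v (btw_left v w)

theorem mem_compOf_comm {A : Finset V} {v w : V} : w ∈ compOf G A v ↔ v ∈ compOf G A w := by
  simp only [mem_compOf]
  exact ⟨fun h x hx => h x hx.symm, fun h x hx => h x hx.symm⟩

theorem mem_compOf_trans (hG : G.IsTree) {A : Finset V} {u v w : V} (h : v ∈ compOf G A u)
    (h' : w ∈ compOf G A v) : w ∈ compOf G A u := by
  rw [mem_compOf] at *
  intro x hx
  exact (hx.cases hG v).elim (h x) (h' x)

theorem compOf_eq_of_mem (hG : G.IsTree) {A : Finset V} {v w : V} (h : w ∈ compOf G A v) :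
    compOf G A w = compOf G A v := by
  ext x
  exact ⟨fun hx => mem_compOf_trans hG h hx,
    fun hx => mem_compOf_trans hG (mem_compOf_comm.mp h) hx⟩

theorem gconvex_compOf (hG : G.IsTree) (A : Finset V) (v : V) : GConvex G (compOf G A v) := by
  intro u hu w hw x hx
  rw [← compOf_eq_of_mem hG hu] at hw ⊢
  rw [mem_compOf] at hw ⊢
  exact fun y hy => hw y (hx.trans hG.connected hy)

theorem isSubtree_compOf (hG : G.IsTree) {A : Finset V} {v : V} (hv : v ∈ A) :
    IsSubtree G (compOf G A v) :=
  (isSubtree_iff hG).mpr ⟨⟨v, self_mem_compOf hG.connected hv⟩, gconvex_compOf hG A v⟩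

theorem GConvex.subset_compOf {A D : Finset V} (hD : GConvex G D) (hDA : D ⊆ A) {v : V}
    (hv : v ∈ D) : D ⊆ compOf G A v := fun w hw =>
  mem_compOf.mpr fun x hx => hDA (hD v hv w hw x hx)

theorem mem_components_iff (hG : G.IsTree) {A C : Finset V} :
    C ∈ components G A ↔ ∃ v ∈ A, C = compOf G A v := by
  classical
  simp only [components, Finset.mem_filter, Finset.mem_powerset]
  constructor
  · rintro ⟨hCA, hC⟩
    obtain ⟨⟨v, hv⟩, hconv⟩ := (isSubtree_iff hG).mp hC.prop.2
    refine ⟨v, hCA hv, ?_⟩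
    have hsub := hconv.subset_compOf hCA hv
    exact le_antisymm hsub
      (hC.2 ⟨compOf_subset A v, isSubtree_compOf hG (hCA hv)⟩ hsub)
  · rintro ⟨v, hv, rfl⟩
    refine ⟨compOf_subset A v, ⟨compOf_subset A v, isSubtree_compOf hG hv⟩, ?_⟩
    rintro D ⟨hDA, hD⟩ hsub
    exact ((isSubtree_iff hG).mp hD).2.subset_compOf hDA
      (hsub (self_mem_compOf hG.connected hv))

theorem isSubtree_of_mem_components (hG : G.IsTree) {A C : Finset V} (h : C ∈ components G A) :
    IsSubtree G C := by
  obtain ⟨v, hv, rfl⟩ := (mem_components_iff hG).mp h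
  exact isSubtree_compOf hG hv

theorem eq_of_mem_components (hG : G.IsTree) {A C D : Finset V} (hC : C ∈ components G A)
    (hD : D ∈ components G A) {x : V} (hxC : x ∈ C) (hxD : x ∈ D) : C = D := by
  obtain ⟨v, hv, rfl⟩ := (mem_components_iff hG).mp hC
  obtain ⟨w, hw, rfl⟩ := (mem_components_iff hG).mp hD
  rw [← compOf_eq_of_mem hG hxC, ← compOf_eq_of_mem hG hxD]

theorem pairwiseDisjoint_components (hG : G.IsTree) (A : Finset V) :
    (components G A : Set (Finset V)).PairwiseDisjoint id := by
  intro C hC D hD hne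
  rw [Function.onFun, Finset.disjoint_left]
  exact fun x hx hx' => hne (eq_of_mem_components hG hC hD hx hx')

theorem sum_card_components_le (hG : G.IsTree) (A : Finset V) :
    ∑ C ∈ components G A, C.card ≤ A.card := by
  classical
  have h := Finset.card_biUnion (pairwiseDisjoint_components hG A)
  simp only [id] at h
  rw [← h]
  exact Finset.card_le_card (Finset.biUnion_subset.mpr fun C hC => subset_of_mem_components hC)

theorem mem_boundary [Fintype V] {S : Finset V} {v : V} :
    v ∈ boundary G S ↔ v ∉ S ∧ ∃ u ∈ S, G.Adj u v := by
  simp [boundary]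

theorem boundary_compOf_subset [Fintype V] [DecidableEq V] (hG : G.IsTree) (A : Finset V) (v : V) :
    boundary G (compOf G A v) ⊆ Aᶜ := by
  intro y hy
  rw [mem_boundary] at hy
  obtain ⟨hy, x, hx, hxy⟩ := hy
  rw [Finset.mem_compl]
  intro hyA
  refine hy (mem_compOf_trans hG hx (mem_compOf.mpr fun z hz => ?_))
  have h1 := SimpleGraph.dist_eq_one_iff_adj.mpr hxy
  by_cases hzx : x = z
  · exact hzx ▸ compOf_subset A v hx
  · have h2 := hG.connected.pos_dist_of_ne hzx
    unfold Btw at hz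
    have : z = y := hG.connected.dist_eq_zero_iff.mp (by omega)
    exact this ▸ hyA

/-- Removing a vertex adds at most this vertex to the boundary. -/
theorem boundary_component_subset [Fintype V] [DecidableEq V] (hG : G.IsTree) {S C : Finset V}
    {r : V} (hC : C ∈ components G (S.erase r)) : boundary G C ⊆ insert r (boundary G S) := by
  obtain ⟨v, hv, rfl⟩ := (mem_components_iff hG).mp hC
  intro y hy
  have h1 := boundary_compOf_subset hG _ _ hy
  rw [mem_boundary] at hy
  obtain ⟨-, x, hx, hxy⟩ := hy
  rw [Finset.mem_insert, mem_boundary]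
  rw [Finset.mem_compl, Finset.mem_erase, not_and] at h1
  by_cases hyr : y = r
  · exact Or.inl hyr
  · exact Or.inr ⟨h1 hyr, x, Finset.mem_of_mem_erase (compOf_subset _ _ hx), hxy⟩

/-- A subtree is the component of any of its vertices once its boundary is removed. -/
theorem compOf_compl_boundary [Fintype V] [DecidableEq V] (hG : G.IsTree) {S : Finset V}
    (hS : IsSubtree G S) {v : V} (hv : v ∈ S) : compOf G (boundary G S)ᶜ v = S := by
  have hc := ((isSubtree_iff hG).mp hS).2
  refine subset_antisymm (fun w hw => ?_) (hc.subset_compOf (fun x hx => ?_) hv)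
  · -- otherwise a walk from `v` to `w` leaves `S` through the boundary
    by_contra hwS
    have hne : v ≠ w := fun h => hwS (h ▸ hv)
    obtain ⟨p, hp⟩ := hG.connected.exists_walk_length_eq_dist v w
    obtain ⟨d, hd, h1, h2⟩ := p.exists_boundary_dart (S : Set V) hv hwS
    have h3 : Btw G v d.snd w := (btw_iff_exists_walk hG.connected).mpr
      ⟨p, hp, p.dart_snd_mem_support_of_mem_darts hd⟩
    have h4 := mem_compOf.mp hw _ h3
    rw [Finset.mem_compl, mem_boundary] at h4
    exact h4 ⟨h2, d.fst, h1, d.adj⟩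
  · rw [Finset.mem_compl, mem_boundary]
    exact fun h => h.1 hx

end TreeMetric

/-! ### The dynamic program without boundary bound -/

section Optimum

variable {V : Type*} [Fintype V] [DecidableEq V] {G : SimpleGraph V}

theorem dp_eq {k : ℕ} {S : Finset V} (h : (boundary G S).card ≤ k) :
    dp G k S = (S.card : ℕ∞) + ⨅ r : {r // r ∈ S},
      ∑ C ∈ components G (S.erase r.1), dp G k C := by
  rw [dp, if_pos h]
  congr 1
  refine iInf_congr fun r => ?_
  rw [Finset.sum_coe_sort (components G _) (fun C => dp G k C)]
  congr!

theorem dp_eq_top {k : ℕ} {S : Finset V} (h : ¬ (boundary G S).card ≤ k) : dp G k S = ⊤ := by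
  rw [dp, if_neg h]

theorem card_lt_of_mem_components {S C : Finset V} {r : V} (hr : r ∈ S)
    (hC : C ∈ components G (S.erase r)) : C.card < S.card :=
  lt_of_le_of_lt (Finset.card_le_card (subset_of_mem_components hC))
    (Finset.card_erase_lt_of_mem hr)

/-- The dynamic program with a boundary bound that is never exceeded. -/
noncomputable def opt (G : SimpleGraph V) (S : Finset V) : ℕ∞ :=
  dp G (Fintype.card V) S

theorem opt_eq (G : SimpleGraph V) (S : Finset V) :
    opt G S = (S.card : ℕ∞) + ⨅ r : {r // r ∈ S},
      ∑ C ∈ components G (S.erase r.1), opt G C :=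
  dp_eq (Finset.card_le_univ _)

theorem opt_le_dp (k : ℕ) (S : Finset V) : opt G S ≤ dp G k S := by
  induction hm : S.card using Nat.strong_induction_on generalizing S with
  | _ m ih =>
    subst hm
    by_cases h : (boundary G S).card ≤ k
    · rw [dp_eq h, opt_eq]
      gcongr with r C hC
      exact ih _ (card_lt_of_mem_components r.2 hC) C rfl
    · rw [dp_eq_top h]
      exact le_top

/-- The vertex `r` is an optimal choice in the recursion for `S`. -/
def IsBestRoot (G : SimpleGraph V) (S : Finset V) (r : V) : Prop :=
  r ∈ S ∧ opt G S = (S.card : ℕ∞) + ∑ C ∈ components G (S.erase r), opt G C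

theorem exists_isBestRoot {S : Finset V} (hS : S.Nonempty) : ∃ r, IsBestRoot G S r := by
  have : Nonempty {r // r ∈ S} := ⟨⟨_, hS.choose_spec⟩⟩
  obtain ⟨r, hr⟩ := ciInf_mem fun r : {r // r ∈ S} =>
    ∑ C ∈ components G (S.erase r.1), opt G C
  exact ⟨r.1, r.2, by rw [opt_eq, ← hr]⟩

/-! ### Hub labelings of subtrees -/

/-- The pairs `(u, w)` in `P`, read as `w ∈ H u`, form a hub labeling of the subtree `S`. -/
def Labels (G : SimpleGraph V) (S : Finset V) (P : Finset (V × V)) : Prop :=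
  ∀ u ∈ S, ∀ v ∈ S, ∃ w, (u, w) ∈ P ∧ (v, w) ∈ P ∧ Btw G u w v

theorem Labels.self_mem (hG : G.IsTree) {S : Finset V} {P : Finset (V × V)} (h : Labels G S P)
    {u : V} (hu : u ∈ S) : (u, u) ∈ P := by
  obtain ⟨w, hw, -, hb⟩ := h u hu u hu
  rwa [hb.eq_of_self hG.connected] at hw

/-- A map of a subtree into itself that moves each vertex to a neighbour flips some edge. -/
theorem exists_flipped_edge (hG : G.IsTree) {S : Finset V} (hS : S.Nonempty) {f : V → V}
    (hf : ∀ x ∈ S, f x ∈ S ∧ G.Adj x (f x)) : ∃ x ∈ S, f (f x) = x := by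
  obtain ⟨ρ, hρ⟩ := hS
  -- the farthest vertex from `ρ` that is moved away from `ρ`
  obtain ⟨x, hx, hmax⟩ := (S.filter fun x => G.dist ρ (f x) = G.dist ρ x + 1).exists_max_image
    (fun x => G.dist ρ x) ⟨ρ, by
      simp [hρ, SimpleGraph.dist_eq_one_iff_adj.mpr (hf ρ hρ).2]⟩
  rw [Finset.mem_filter] at hx
  obtain ⟨hxS, hx⟩ := hx
  obtain ⟨hy, hxy⟩ := hf x hxS
  obtain ⟨hz, hyz⟩ := hf _ hy
  refine ⟨x, hxS, ?_⟩
  have hcl : G.dist ρ (f x) = G.dist ρ (f (f x)) + 1 := by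
    rcases hG.dist_eq_dist_add_one_of_adj ρ hyz with h | h
    · exact h
    · have := hmax (f x) (Finset.mem_filter.mpr ⟨hy, h⟩)
      omega
  exact eq_of_adj_of_closer hG hyz.symm hxy hcl hx

/-- The subtrees spanned by the hubs of the vertices have a common vertex `r` (the Helly property):
each vertex `u` has a hub `z` such that `r` lies between `u` and `z`. -/
theorem Labels.exists_root (hG : G.IsTree) {S : Finset V} {P : Finset (V × V)}
    (hS : IsSubtree G S) (h : Labels G S P) :
    ∃ r ∈ S, ∀ u ∈ S, ∃ z, (u, z) ∈ P ∧ Btw G u r z := by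
  obtain ⟨hne, hc⟩ := (isSubtree_iff hG).mp hS
  by_contra! hcon
  choose! b hb hbP using hcon
  have hbne : ∀ x ∈ S, x ≠ b x := fun x hx he =>
    hbP x hx (b x) (h.self_mem hG (hb x hx)) (by rw [← he]; exact btw_left _ _)
  have hstep : ∀ x, ∃ y, x ∈ S → G.Adj x y ∧ Btw G x y (b x) := by
    intro x
    by_cases hx : x ∈ S
    · obtain ⟨y, hy⟩ := exists_adj_btw hG.connected (hbne x hx)
      exact ⟨y, fun _ => hy⟩
    · exact ⟨x, fun h => absurd h hx⟩
  choose f hf using hstep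
  obtain ⟨x, hx, hfx⟩ := exists_flipped_edge hG hne (f := f) fun x hx =>
    ⟨hc x hx _ (hb x hx) _ (hf x hx).2, (hf x hx).1⟩
  have hy : f x ∈ S := hc x hx _ (hb x hx) _ (hf x hx).2
  obtain ⟨hxy, hxb⟩ := hf x hx
  obtain ⟨-, hyb⟩ := hf _ hy
  rw [hfx] at hyb
  obtain ⟨w, hu, hv, -⟩ := h _ (hb x hx) _ (hb _ hy)
  have e := SimpleGraph.dist_eq_one_iff_adj.mpr hxy
  have e' := SimpleGraph.dist_eq_one_iff_adj.mpr hxy.symm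
  have h1 : G.dist (b x) x = G.dist (b x) (f x) + 1 := by
    have := hxb.symm
    unfold Btw at this
    omega
  have h2 : G.dist (b (f x)) (f x) = G.dist (b (f x)) x + 1 := by
    have := hyb.symm
    unfold Btw at this
    omega
  -- a common hub `w` of `b x` and `b (f x)` lies on one of the two sides of the edge
  rcases hG.dist_eq_dist_add_one_of_adj w hxy with h3 | h3
  · exact hbP _ hy w hv (Btw.of_adj_of_adj hG hxy h3 h2).symm
  · exact hbP _ hx w hu (Btw.of_adj_of_adj hG hxy.symm h3 h1).symm

/-- Every hub labeling of a subtree costs at least the value of the dynamic program. -/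
theorem Labels.opt_le (hG : G.IsTree) {S : Finset V} {P : Finset (V × V)}
    (hS : IsSubtree G S) (h : Labels G S P) : opt G S ≤ P.card := by
  induction hm : S.card using Nat.strong_induction_on generalizing S P with
  | _ m ih =>
    subst hm
    obtain ⟨r, hr, hroot⟩ := h.exists_root hG hS
    choose! z hz hzb using hroot
    let R : Finset V → Finset (V × V) := fun C => P.filter fun p => p.1 ∈ C ∧ p.2 ∈ C
    let Q : Finset (V × V) := S.image fun u => (u, z u)
    have hC : ∀ C ∈ components G (S.erase r), opt G C ≤ (R C).card := by
      intro C hC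
      have hsub := isSubtree_of_mem_components hG hC
      refine ih _ (card_lt_of_mem_components hr hC) hsub (fun u hu v hv => ?_) rfl
      have hCS : C ⊆ S := (subset_of_mem_components hC).trans (Finset.erase_subset _ _)
      obtain ⟨w, h1, h2, hb⟩ := h u (hCS hu) v (hCS hv)
      have hw := ((isSubtree_iff hG).mp hsub).2 u hu v hv w hb
      exact ⟨w, Finset.mem_filter.mpr ⟨h1, hu, hw⟩, Finset.mem_filter.mpr ⟨h2, hv, hw⟩, hb⟩
    have hQ : Q.card = S.card := Finset.card_image_of_injective _ fun a b hab => by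
      simpa using congrArg Prod.fst hab
    have hR : ((components G (S.erase r)).biUnion R).card
        = ∑ C ∈ components G (S.erase r), (R C).card := by
      refine Finset.card_biUnion fun C hC D hD hne => ?_
      rw [Function.onFun, Finset.disjoint_left]
      intro p hp hp'
      exact hne (eq_of_mem_components hG hC hD (Finset.mem_filter.mp hp).2.1
        (Finset.mem_filter.mp hp').2.1)
    -- the pairs `(u, z u)` cross the root, so they belong to none of the components
    have hdisj : Disjoint Q ((components G (S.erase r)).biUnion R) := by
      rw [Finset.disjoint_left]
      intro p hp hp'
      obtain ⟨u, hu, rfl⟩ := Finset.mem_image.mp hp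
      obtain ⟨C, hC, hpC⟩ := Finset.mem_biUnion.mp hp'
      obtain ⟨-, h1, h2⟩ := Finset.mem_filter.mp hpC
      have h3 := ((isSubtree_iff hG).mp (isSubtree_of_mem_components hG hC)).2 _ h1 _ h2 r
        (hzb u hu)
      simpa using subset_of_mem_components hC h3
    have hsub : Q ∪ (components G (S.erase r)).biUnion R ⊆ P := by
      refine Finset.union_subset (fun p hp => ?_)
        (Finset.biUnion_subset.mpr fun C _ => Finset.filter_subset _ _)
      obtain ⟨u, hu, rfl⟩ := Finset.mem_image.mp hp
      exact hz u hu
    have hcard := Finset.card_le_card hsub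
    rw [Finset.card_union_of_disjoint hdisj, hQ, hR] at hcard
    calc opt G S ≤ (S.card : ℕ∞) + ∑ C ∈ components G (S.erase r), opt G C := by
          rw [opt_eq]
          gcongr
          exact iInf_le (fun r : {r // r ∈ S} => ∑ C ∈ components G (S.erase r.1), opt G C)
            ⟨r, hr⟩
      _ ≤ (S.card : ℕ∞) + ∑ C ∈ components G (S.erase r), ((R C).card : ℕ∞) := by
          gcongr with C h'
          exact hC C h'
      _ ≤ P.card := by exact_mod_cast hcard

/-- Labelings of the components of `S - r` form a labeling of `S` once `r` is added to every
label. -/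
theorem Labels.glue (hG : G.IsTree) {S : Finset V} (hS : IsSubtree G S) {r : V}
    {R : Finset V → Finset (V × V)} {P : Finset (V × V)}
    (hR : ∀ C ∈ components G (S.erase r), Labels G C (R C))
    (hP : ∀ C ∈ components G (S.erase r), R C ⊆ P) (hr : ∀ u ∈ S, (u, r) ∈ P) :
    Labels G S P := by
  intro u hu v hv
  by_cases hb : Btw G u r v
  · exact ⟨r, hr u hu, hr v hv, hb⟩
  · have hconv := ((isSubtree_iff hG).mp hS).2
    have hmem : v ∈ compOf G (S.erase r) u := by
      rw [mem_compOf]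
      intro x hx
      refine Finset.mem_erase.mpr ⟨?_, hconv u hu v hv x hx⟩
      rintro rfl
      exact hb hx
    have hu' := mem_of_mem_compOf hmem
    have hC := (mem_components_iff hG).mpr ⟨u, hu', rfl⟩
    obtain ⟨w, h1, h2, h3⟩ := hR _ hC u (self_mem_compOf hG.connected hu') v hmem
    exact ⟨w, hP _ hC h1, hP _ hC h2, h3⟩

/-- A labeling whose cost is at most the value of the dynamic program. -/
def IsOptLabels (G : SimpleGraph V) (S : Finset V) (P : Finset (V × V)) : Prop :=
  Labels G S P ∧ (P.card : ℕ∞) ≤ opt G S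

theorem IsOptLabels.glue (hG : G.IsTree) {S : Finset V} (hS : IsSubtree G S) {r : V}
    (hr : IsBestRoot G S r) {R : Finset V → Finset (V × V)}
    (hR : ∀ C ∈ components G (S.erase r), IsOptLabels G C (R C)) :
    IsOptLabels G S (S.image (fun u => (u, r)) ∪ (components G (S.erase r)).biUnion R) := by
  refine ⟨Labels.glue hG hS (fun C hC => (hR C hC).1) (fun C hC => ?_) (fun u hu => ?_), ?_⟩
  · exact (Finset.subset_biUnion_of_mem R hC).trans Finset.subset_union_right
  · exact Finset.mem_union_left _ (Finset.mem_image_of_mem _ hu)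
  · rw [hr.2]
    calc _ ≤ ((S.card + ∑ C ∈ components G (S.erase r), (R C).card : ℕ) : ℕ∞) := by
          exact_mod_cast (Finset.card_union_le _ _).trans
            (Nat.add_le_add Finset.card_image_le Finset.card_biUnion_le)
      _ ≤ _ := by
          push_cast
          gcongr with C hC
          exact (hR C hC).2

theorem exists_isOptLabels (hG : G.IsTree) {S : Finset V} (hS : IsSubtree G S) :
    ∃ P, IsOptLabels G S P := by
  induction hm : S.card using Nat.strong_induction_on generalizing S with
  | _ m ih =>
    subst hm
    obtain ⟨r, hr⟩ := exists_isBestRoot (G := G) ((isSubtree_iff hG).mp hS).1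
    have : ∀ C, ∃ P, C ∈ components G (S.erase r) → IsOptLabels G C P := by
      intro C
      by_cases hC : C ∈ components G (S.erase r)
      · obtain ⟨P, hP⟩ := ih _ (card_lt_of_mem_components hr.1 hC)
          (isSubtree_of_mem_components hG hC) rfl
        exact ⟨P, fun _ => hP⟩
      · exact ⟨∅, fun h => absurd h hC⟩
    choose R hR using this
    exact ⟨_, IsOptLabels.glue hG hS hr hR⟩

/-! ### Optimal recursions have logarithmic depth -/

/-- A centroid `c` of `S`: for every `r` in `S`, at least half of the vertices of `S` have `c`
between them and `r`. A vertex with minimal total distance has this property. -/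
theorem exists_centroid (hG : G.IsTree) {S : Finset V} (hS : IsSubtree G S) :
    ∃ c ∈ S, ∀ r ∈ S, S.card ≤ 2 * (S.filter fun u => Btw G u c r).card := by
  obtain ⟨hne, hc⟩ := (isSubtree_iff hG).mp hS
  obtain ⟨c, hcS, hmin⟩ := S.exists_min_image (fun x => ∑ u ∈ S, G.dist u x) hne
  refine ⟨c, hcS, fun r hr => ?_⟩
  by_cases hcr : c = r
  · subst hcr
    rw [Finset.filter_true_of_mem fun u _ => btw_right u c]
    omega
  obtain ⟨y, hcy, hb⟩ := exists_adj_btw hG.connected hcr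
  have hy := hc c hcS r hr y hb
  have e := SimpleGraph.dist_eq_one_iff_adj.mpr hcy
  have hry : G.dist r c = G.dist r y + 1 := by
    have := hb.symm
    rw [Btw, G.dist_comm (u := y), e] at this
    omega
  have hsum := hmin y hy
  -- stepping from `c` to `y` decreases the distance only for vertices that do not have `c` on
  -- their way to `r`
  have hcase : ∀ u ∈ S, G.dist u y + 1 ≤ G.dist u c + if Btw G u c r then 2 else 0 := by
    intro u _
    rcases hG.dist_eq_dist_add_one_of_adj u hcy with h | h
    · omega
    · have := (Btw.of_adj_of_adj hG hcy.symm h hry)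
      rw [if_pos this]
      omega
  have h := Finset.sum_le_sum hcase
  rw [Finset.sum_add_distrib, Finset.sum_add_distrib, Finset.sum_const, smul_eq_mul, mul_one,
    ← Finset.sum_filter, Finset.sum_const, smul_eq_mul] at h
  omega

/-- Moving the vertex `c` to the top of the labels keeps a labeling: `c` becomes a hub of every
vertex and all the hubs beyond `c` are dropped. Hence an optimal labeling has at most `|S|` pairs
that cross `c`. -/
theorem IsOptLabels.card_cross_le (hG : G.IsTree) {S : Finset V} {P : Finset (V × V)}
    (hS : IsSubtree G S) (h : IsOptLabels G S P) (c : V) :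
    (P.filter fun p => Btw G p.1 c p.2).card ≤ S.card := by
  let P' := S.image (fun u => (u, c)) ∪ P.filter fun p => ¬ Btw G p.1 c p.2
  have hP' : Labels G S P' := by
    intro u hu v hv
    by_cases hb : Btw G u c v
    · exact ⟨c, Finset.mem_union_left _ (Finset.mem_image_of_mem _ hu),
        Finset.mem_union_left _ (Finset.mem_image_of_mem _ hv), hb⟩
    · obtain ⟨w, h1, h2, h3⟩ := h.1 u hu v hv
      exact ⟨w, Finset.mem_union_right _ (Finset.mem_filter.mpr
          ⟨h1, fun h4 => hb (h3.trans hG.connected h4)⟩),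
        Finset.mem_union_right _ (Finset.mem_filter.mpr
          ⟨h2, fun h4 => hb (h3.symm.trans hG.connected h4).symm⟩), h3⟩
  have h1 : P.card ≤ P'.card := by
    exact_mod_cast h.2.trans (hP'.opt_le hG hS)
  have h2 : P'.card ≤ S.card + _ :=
    (Finset.card_union_le _ _).trans (Nat.add_le_add_right Finset.card_image_le _)
  have h3 := Finset.card_filter_add_card_filter_not (s := P) fun p => Btw G p.1 c p.2
  omega

/-- `Chain G S D R`: the subtree `D` is reached from `S` by successively removing the vertices
of `R`, each one an optimal root, and passing to a component. -/
inductive Chain (G : SimpleGraph V) : Finset V → Finset V → Finset V → Prop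
  | refl (S : Finset V) : Chain G S S ∅
  | cons {S C D R : Finset V} {r : V} (hr : IsBestRoot G S r)
      (hC : C ∈ components G (S.erase r)) (h : Chain G C D R) : Chain G S D (insert r R)

theorem Chain.snoc {S D C R : Finset V} {r : V} (h : Chain G S D R) (hr : IsBestRoot G D r)
    (hC : C ∈ components G (D.erase r)) : Chain G S C (insert r R) := by
  induction h with
  | refl S => exact Chain.cons hr hC (Chain.refl C)
  | @cons S C' D R r' hr' hC' h ih =>
    rw [Finset.insert_comm]
    exact Chain.cons hr' hC' (ih hr hC)

theorem Chain.subset {S D R : Finset V} (h : Chain G S D R) : D ⊆ S := by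
  induction h with
  | refl S => exact subset_rfl
  | cons hr hC h ih =>
    exact ih.trans ((subset_of_mem_components hC).trans (Finset.erase_subset _ _))

theorem Chain.roots_subset {S D R : Finset V} (h : Chain G S D R) : R ⊆ S := by
  induction h with
  | refl S => simp
  | cons hr hC h ih =>
    exact Finset.insert_subset hr.1
      (ih.trans ((subset_of_mem_components hC).trans (Finset.erase_subset _ _)))

theorem Chain.isSubtree (hG : G.IsTree) {S D R : Finset V} (h : Chain G S D R)
    (hS : IsSubtree G S) : IsSubtree G D := by
  induction h with
  | refl S => exact hS
  | cons hr hC h ih => exact ih (isSubtree_of_mem_components hG hC)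

theorem Chain.boundary_subset (hG : G.IsTree) {S D R : Finset V} (h : Chain G S D R) :
    boundary G D ⊆ R ∪ boundary G S := by
  induction h with
  | refl S => simp
  | cons hr hC h ih =>
    refine ih.trans (Finset.union_subset ?_ ((boundary_component_subset hG hC).trans ?_))
    · exact (Finset.subset_insert _ _).trans Finset.subset_union_left
    · exact Finset.insert_subset (by simp) Finset.subset_union_right

theorem Chain.card_insert {S C D R : Finset V} {r : V} (hC : C ∈ components G (S.erase r))
    (h : Chain G C D R) : (insert r R).card = R.card + 1 :=
  Finset.card_insert_of_notMem fun hr => by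
    simpa using subset_of_mem_components hC (h.roots_subset hr)

/-- Some optimal labeling of `S` has all the roots of a chain in the labels of its last subtree. -/
theorem Chain.exists_labels (hG : G.IsTree) {S D R : Finset V} (h : Chain G S D R)
    (hS : IsSubtree G S) :
    ∃ P, IsOptLabels G S P ∧ ∀ u ∈ D, ∀ r ∈ R, (u, r) ∈ P := by
  induction h with
  | refl S =>
    obtain ⟨P, hP⟩ := exists_isOptLabels hG hS
    exact ⟨P, hP, by simp⟩
  | @cons S C D R r hr hC h ih =>
    obtain ⟨P, hP, hPR⟩ := ih (isSubtree_of_mem_components hG hC)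
    have : ∀ E, ∃ Q, (E ∈ components G (S.erase r) → IsOptLabels G E Q) ∧ (E = C → Q = P) := by
      intro E
      by_cases hE : E ∈ components G (S.erase r)
      · by_cases hEC : E = C
        · subst hEC
          exact ⟨P, fun _ => hP, fun _ => rfl⟩
        · obtain ⟨Q, hQ⟩ := exists_isOptLabels hG (isSubtree_of_mem_components hG hE)
          exact ⟨Q, fun _ => hQ, fun h => absurd h hEC⟩
      · exact ⟨P, fun h => absurd h hE, fun _ => rfl⟩
    choose Q hQ hQC using this
    refine ⟨_, IsOptLabels.glue hG hS hr hQ, fun u hu s hs => ?_⟩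
    have huC := h.subset hu
    rcases Finset.mem_insert.mp hs with rfl | hs
    · exact Finset.mem_union_left _ (Finset.mem_image_of_mem _
        (Finset.mem_of_mem_erase (subset_of_mem_components hC huC)))
    · refine Finset.mem_union_right _ (Finset.mem_biUnion.mpr ⟨C, hC, ?_⟩)
      rw [hQC C rfl]
      exact hPR u hu s hs

/-- Along an optimal recursion, the subtrees shrink: each of the many roots above a large
subtree `D` would be cut off from half of `S` by a centroid. -/
theorem Chain.card_mul_le (hG : G.IsTree) {S D R : Finset V} (h : Chain G S D R)
    (hS : IsSubtree G S) : R.card * (2 * D.card) ≤ (R.card + 2) * S.card := by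
  obtain ⟨P, hP, hPR⟩ := h.exists_labels hG hS
  obtain ⟨c, hc, hcent⟩ := exists_centroid hG hS
  have h1 := hP.card_cross_le hG hS c
  have h2 : (R.sigma fun r => D.filter fun u => Btw G u c r).card
      ≤ (P.filter fun p => Btw G p.1 c p.2).card := by
    refine Finset.card_le_card_of_injOn (fun x => (x.2, x.1)) ?_ ?_
    · rintro ⟨r, u⟩ hx
      simp only [Finset.coe_sigma, Set.mem_sigma_iff, Finset.mem_coe, Finset.mem_filter] at hx ⊢
      exact ⟨hPR u hx.2.1 r hx.1, hx.2.2⟩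
    · rintro ⟨r, u⟩ - ⟨r', u'⟩ - hx
      simp only [Prod.mk.injEq] at hx
      obtain ⟨rfl, rfl⟩ := hx
      rfl
  rw [Finset.card_sigma] at h2
  have h3 : ∀ r ∈ R, 2 * D.card ≤ S.card + 2 * (D.filter fun u => Btw G u c r).card := by
    intro r hr
    have h4 := hcent r (h.roots_subset hr)
    have h5 := Finset.card_filter_add_card_filter_not (s := S) fun u => Btw G u c r
    have h6 := Finset.card_filter_add_card_filter_not (s := D) fun u => Btw G u c r
    have h7 : (D.filter fun u => ¬ Btw G u c r).card ≤ (S.filter fun u => ¬ Btw G u c r).card :=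
      Finset.card_le_card (Finset.filter_subset_filter _ h.subset)
    omega
  have h4 := Finset.sum_le_sum h3
  rw [Finset.sum_const, Finset.sum_add_distrib, Finset.sum_const, ← Finset.mul_sum, smul_eq_mul,
    smul_eq_mul] at h4
  nlinarith

theorem Chain.split {S D R : Finset V} (h : Chain G S D R) :
    ∀ j ≤ R.card, ∃ M R₁ R₂, Chain G S M R₁ ∧ Chain G M D R₂ ∧ R₁.card = j ∧
      R.card = j + R₂.card := by
  induction h with
  | refl S =>
    intro j hj
    obtain rfl : j = 0 := by simpa using hj
    exact ⟨S, ∅, ∅, Chain.refl S, Chain.refl S, by simp, by simp⟩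
  | @cons S C D R r hr hC h ih =>
    intro j hj
    cases j with
    | zero => exact ⟨S, ∅, _, Chain.refl S, Chain.cons hr hC h, by simp, by simp⟩
    | succ j =>
      rw [Chain.card_insert hC h] at hj ⊢
      obtain ⟨M, R₁, R₂, h1, h2, h3, h4⟩ := ih j (by omega)
      exact ⟨M, insert r R₁, R₂, Chain.cons hr hC h1, h2, by rw [Chain.card_insert hC h1, h3],
        by omega⟩

theorem Chain.card_le_log (hG : G.IsTree) {S D R : Finset V} (h : Chain G S D R)
    (hS : IsSubtree G S) : R.card ≤ 10 * Nat.log 2 S.card + 9 := by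
  induction hm : S.card using Nat.strong_induction_on generalizing S R with
  | _ m ih =>
    subst hm
    by_contra! hlt
    -- five roots reduce the size by the factor `7 / 10`, so ten of them halve it
    obtain ⟨M, R₁, R', h1, h', h2, h3⟩ := h.split 5 (by omega)
    obtain ⟨N, R₂, R₃, h4, h5, h6, h7⟩ := h'.split 5 (by omega)
    have hM := h1.isSubtree hG hS
    have hN := h4.isSubtree hG hM
    have e1 := h1.card_mul_le hG hS
    have e2 := h4.card_mul_le hG hM
    rw [h2] at e1
    rw [h6] at e2
    have hpos : 0 < N.card := ((isSubtree_iff hG).mp hN).1.card_pos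
    have := ih N.card (by omega) h5 hN rfl
    have hlog : Nat.log 2 (N.card * 2) ≤ Nat.log 2 S.card := Nat.log_mono_right (by omega)
    rw [Nat.log_mul_base (by norm_num) hpos.ne'] at hlog
    omega

theorem isSubtree_univ (hG : G.IsTree) : IsSubtree G Finset.univ :=
  (isSubtree_iff hG).mpr
    ⟨Finset.univ_nonempty_iff.mpr hG.connected.nonempty, fun _ _ _ _ _ _ => Finset.mem_univ _⟩

theorem boundary_univ : boundary G Finset.univ = ∅ := by
  ext v
  simp [mem_boundary]

theorem dp_eq_opt_of_chain (hG : G.IsTree) {k : ℕ}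
    (hk : ∀ D R, Chain G Finset.univ D R → R.card ≤ k) {D R : Finset V}
    (h : Chain G Finset.univ D R) : dp G k D = opt G D := by
  induction hm : D.card using Nat.strong_induction_on generalizing D R with
  | _ m ih =>
    subst hm
    refine le_antisymm ?_ (opt_le_dp k D)
    have hb : (boundary G D).card ≤ k := by
      have := h.boundary_subset hG
      rw [boundary_univ, Finset.union_empty] at this
      exact (Finset.card_le_card this).trans (hk D R h)
    obtain ⟨r, hr⟩ := exists_isBestRoot (G := G)
      ((isSubtree_iff hG).mp (h.isSubtree hG (isSubtree_univ hG))).1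
    rw [dp_eq hb, hr.2]
    gcongr
    refine (iInf_le _ ⟨r, hr.1⟩).trans (le_of_eq (Finset.sum_congr rfl fun C hC => ?_))
    exact ih _ (card_lt_of_mem_components hr.1 hC) (h.snoc hr hC) rfl

/-- A logarithmic bound on the boundary does not change the value of the whole tree. -/
theorem dp_log_univ (hG : G.IsTree) :
    dp G (19 * Nat.log 2 (Fintype.card V)) Finset.univ = opt G Finset.univ := by
  refine dp_eq_opt_of_chain hG (fun D R h => ?_) (Chain.refl _)
  have h1 := h.card_le_log hG (isSubtree_univ hG)
  rw [Finset.card_univ] at h1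
  by_cases h2 : 2 ≤ Fintype.card V
  · -- here `10 * log n + 9 ≤ 19 * log n`, as the logarithm is positive
    have := Nat.log_pos (b := 2) (by norm_num) h2
    omega
  · -- with a single vertex, no component is left after a removal
    cases h with
    | refl => simp
    | @cons _ C _ _ r hr hC h =>
      have h3 := card_lt_of_mem_components hr.1 hC
      have h4 := ((isSubtree_iff hG).mp (isSubtree_of_mem_components hG hC)).1.card_pos
      rw [Finset.card_univ] at h3
      omega

end Optimum

/-! ### Computability with resource bounds -/

section Resources

/-- Types whose elements are represented by binary trees. -/
class Enc (α : Type) where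
  enc : α → Data

open Enc

instance : Enc Bool := ⟨encBool⟩

instance : Enc Unit := ⟨fun _ => .nil⟩

instance {α : Type} [Enc α] : Enc (List α) := ⟨encList enc⟩

instance {α β : Type} [Enc α] [Enc β] : Enc (α × β) := ⟨fun p => .cons (enc p.1) (enc p.2)⟩

instance {α : Type} [Enc α] : Enc (Option α) := ⟨fun o => o.elim .nil fun a => .cons .nil (enc a)⟩

/-- The number of nodes of a binary tree. -/
def Data.size : Data → ℕ
  | .nil => 1
  | .cons a b => a.size + b.size + 1

variable {α β γ : Type} [Enc α] [Enc β] [Enc γ]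

/-- The size of the representation of `a`. -/
def sz (a : α) : ℕ := (enc a).size

@[simp] theorem enc_nil : enc ([] : List α) = .nil := rfl

@[simp] theorem enc_cons (a : α) (l : List α) : enc (a :: l) = .cons (enc a) (enc l) := rfl

@[simp] theorem enc_pair (a : α) (b : β) : enc (a, b) = .cons (enc a) (enc b) := rfl

@[simp] theorem enc_some (a : α) : enc (some a) = .cons .nil (enc a) := rfl

@[simp] theorem sz_nil : sz ([] : List α) = 1 := rfl

@[simp] theorem sz_cons (a : α) (l : List α) : sz (a :: l) = sz a + sz l + 1 := rfl

@[simp] theorem sz_pair (a : α) (b : β) : sz (a, b) = sz a + sz b + 1 := rfl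

@[simp] theorem sz_none : sz (none : Option α) = 1 := rfl

@[simp] theorem sz_some (a : α) : sz (some a) = sz a + 2 := by
  simp only [sz, enc_some, Data.size]
  omega

@[simp] theorem sz_unit (u : Unit) : sz u = 1 := rfl

@[simp] theorem sz_true : sz true = 3 := rfl

@[simp] theorem sz_false : sz false = 1 := rfl

theorem sz_bool_le (b : Bool) : sz b ≤ 3 := by cases b <;> simp

theorem sz_pos (a : α) : 1 ≤ sz a := by
  unfold sz
  cases enc a <;> simp [Data.size]

theorem length_lt_sz (l : List α) : l.length < sz l := by
  induction l with
  | nil => simp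
  | cons a l ih => simp only [List.length_cons, sz_cons]; omega

theorem sz_le_of_mem {a : α} {l : List α} (h : a ∈ l) : sz a ≤ sz l := by
  induction l with
  | nil => simp at h
  | cons b l ih =>
    rw [sz_cons]
    rcases List.mem_cons.mp h with rfl | h
    · omega
    · have := ih h
      omega

theorem sz_le_of_sublist {l l' : List α} (h : l.Sublist l') : sz l ≤ sz l' := by
  induction h with
  | slnil => exact le_rfl
  | cons a _ ih => rw [sz_cons]; omega
  | cons_cons a _ ih => simp only [sz_cons]; omega

theorem sz_list_le {l : List α} {m : ℕ} (h : ∀ a ∈ l, sz a ≤ m) :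
    sz l ≤ l.length * (m + 1) + 1 := by
  induction l with
  | nil => simp
  | cons a l ih =>
    have h1 := h a List.mem_cons_self
    have h2 := ih fun b hb => h b (List.mem_cons_of_mem _ hb)
    rw [sz_cons, List.length_cons, Nat.add_mul]
    omega

theorem sz_append_le (l l' : List α) : sz (l ++ l') ≤ sz l + sz l' := by
  induction l with
  | nil => simp
  | cons a l ih => rw [List.cons_append, sz_cons, sz_cons]; omega

theorem Eval.append_env {P : Program} {env : List Data} {e : Term} {v : Data} {t : ℕ}
    (h : Eval P env e v t) (env' : List Data) : Eval P (env ++ env') e v t := by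
  induction h with
  | @var env i v h =>
    obtain ⟨hi, -⟩ := List.getElem?_eq_some_iff.mp h
    exact .var (by rwa [List.getElem?_append_left hi])
  | nil => exact .nil
  | cons _ _ iha ihb => exact .cons iha ihb
  | head _ ih => exact .head ih
  | tail _ ih => exact .tail ih
  | ite_cons _ _ ihc iha => exact .ite_cons ihc iha
  | ite_nil _ _ ihc ihb => exact .ite_nil ihc ihb
  | bind _ _ ihe ihb => exact .bind ihe ihb
  | call _ hf hb ihe => exact .call ihe hf hb

theorem Eval.head_cons {P : Program} {env : List Data} {e : Term} {x y : Data} {t : ℕ}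
    (h : Eval P env e (.cons x y) t) : Eval P env (.head e) x (t + 1) :=
  .head h

theorem Eval.tail_cons {P : Program} {env : List Data} {e : Term} {x y : Data} {t : ℕ}
    (h : Eval P env e (.cons x y) t) : Eval P env (.tail e) y (t + 1) :=
  .tail h

/-- The function `f` is computed by some term within `T a` steps on `a`, with a result of size at
most `T a`. The term may call auxiliary functions `R`, which can be placed at any position of a
larger program; this allows for linking terms without renumbering calls. -/
def Computes (f : α → β) (T : α → ℕ) : Prop :=
  (∀ a, sz (f a) ≤ T a) ∧ ∀ q : ℕ, ∃ (R : Program) (e : Term), ∀ Q S : Program, Q.length = q →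
    ∀ a, ∃ t ≤ T a, Eval (Q ++ R ++ S) [enc a] e (enc (f a)) t

/-- A function computed by a term without calls. -/
theorem Computes.of_term {f : α → β} {T : α → ℕ} (e : Term) (hs : ∀ a, sz (f a) ≤ T a)
    (h : ∀ P a, ∃ t ≤ T a, Eval P [enc a] e (enc (f a)) t) : Computes f T :=
  ⟨hs, fun _ => ⟨[], e, fun _ _ _ a => h _ a⟩⟩

theorem Computes.comp {f : α → β} {g : β → γ} {T : α → ℕ} {U : β → ℕ} (hg : Computes g U)
    (hf : Computes f T) : Computes (fun a => g (f a)) fun a => T a + U (f a) + 1 := by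
  refine ⟨fun a => (hg.1 (f a)).trans (by dsimp only; omega), fun q => ?_⟩
  obtain ⟨R₁, e₁, h₁⟩ := hf.2 q
  obtain ⟨R₂, e₂, h₂⟩ := hg.2 (q + R₁.length)
  refine ⟨R₁ ++ R₂, .bind e₁ e₂, fun Q S hQ a => ?_⟩
  obtain ⟨s, hs, he₁⟩ := h₁ Q (R₂ ++ S) hQ a
  obtain ⟨t, ht, he₂⟩ := h₂ (Q ++ R₁) S (by simp [hQ]) (f a)
  simp only [List.append_assoc] at he₁ he₂ ⊢
  exact ⟨s + t + 1, by omega, .bind he₁ (he₂.append_env [enc a])⟩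

theorem Computes.pair {f : α → β} {g : α → γ} {T U : α → ℕ} (hf : Computes f T)
    (hg : Computes g U) : Computes (fun a => (f a, g a)) fun a => T a + U a + 1 := by
  refine ⟨fun a => ?_, fun q => ?_⟩
  · have := hf.1 a
    have := hg.1 a
    simp only [sz_pair]
    omega
  obtain ⟨R₁, e₁, h₁⟩ := hf.2 q
  obtain ⟨R₂, e₂, h₂⟩ := hg.2 (q + R₁.length)
  refine ⟨R₁ ++ R₂, .cons e₁ e₂, fun Q S hQ a => ?_⟩
  obtain ⟨s, hs, he₁⟩ := h₁ Q (R₂ ++ S) hQ a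
  obtain ⟨t, ht, he₂⟩ := h₂ (Q ++ R₁) S (by simp [hQ]) a
  simp only [List.append_assoc] at he₁ he₂ ⊢
  exact ⟨s + t + 1, by omega, .cons he₁ he₂⟩

theorem Computes.cond {c : α → Bool} {f g : α → β} {T U W : α → ℕ} (hc : Computes c T)
    (hf : Computes f U) (hg : Computes g W) :
    Computes (fun a => if c a then f a else g a) fun a => T a + U a + W a + 1 := by
  refine ⟨fun a => ?_, fun q => ?_⟩
  · have := hf.1 a
    have := hg.1 a
    dsimp only
    split_ifs <;> omega
  obtain ⟨R₁, e₁, h₁⟩ := hc.2 q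
  obtain ⟨R₂, e₂, h₂⟩ := hf.2 (q + R₁.length)
  obtain ⟨R₃, e₃, h₃⟩ := hg.2 (q + R₁.length + R₂.length)
  refine ⟨R₁ ++ R₂ ++ R₃, .ite e₁ e₂ e₃, fun Q S hQ a => ?_⟩
  obtain ⟨s, hs, he₁⟩ := h₁ Q (R₂ ++ R₃ ++ S) hQ a
  obtain ⟨t, ht, he₂⟩ := h₂ (Q ++ R₁) (R₃ ++ S) (by simp [hQ]) a
  obtain ⟨u, hu, he₃⟩ := h₃ (Q ++ R₁ ++ R₂) S (by simp [hQ]; omega) a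
  simp only [List.append_assoc] at he₁ he₂ he₃ ⊢
  cases hca : c a
  · rw [hca] at he₁
    exact ⟨s + u + 1, by omega, .ite_nil he₁ he₃⟩
  · rw [hca] at he₁
    exact ⟨s + t + 1, by omega, .ite_cons he₁ he₂⟩

theorem Computes.optionElim {o : α → Option β} {b : α → γ} {s : α → β → γ} {T U W : α → ℕ}
    {X : α × β → ℕ} (ho : Computes o T) (hb : Computes b U)
    (hs : Computes (fun p : α × β => s p.1 p.2) X) (hX : ∀ a, ∀ x ∈ o a, X (a, x) ≤ W a) :
    Computes (fun a => (o a).elim (b a) (s a)) fun a => 2 * T a + U a + W a + 10 := by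
  refine ⟨fun a => ?_, fun q => ?_⟩
  · cases hoa : o a with
    | none => have := hb.1 a; simp only [hoa, Option.elim_none]; omega
    | some x =>
      have h1 := hs.1 (a, x)
      have h2 := hX a x hoa
      simp only [hoa, Option.elim_some] at h1 ⊢
      omega
  obtain ⟨R₁, e₁, h₁⟩ := ho.2 q
  obtain ⟨R₂, e₂, h₂⟩ := hs.2 (q + R₁.length)
  obtain ⟨R₃, e₃, h₃⟩ := hb.2 (q + R₁.length + R₂.length)
  refine ⟨R₁ ++ R₂ ++ R₃, .ite e₁ (.bind (.cons (.var 0) (.tail e₁)) e₂) e₃,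
    fun Q S hQ a => ?_⟩
  obtain ⟨s, hs, he₁⟩ := h₁ Q (R₂ ++ R₃ ++ S) hQ a
  obtain ⟨u, hu, he₃⟩ := h₃ (Q ++ R₁ ++ R₂) S (by simp [hQ]; omega) a
  simp only [List.append_assoc] at he₁ he₃ ⊢
  cases hoa : o a with
  | none =>
    rw [hoa] at he₁
    exact ⟨s + u + 1, by omega, .ite_nil he₁ he₃⟩
  | some x =>
    obtain ⟨t, ht, he₂⟩ := h₂ (Q ++ R₁) (R₃ ++ S) (by simp [hQ]) (a, x)
    have h2 := hX a x hoa
    rw [hoa] at he₁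
    simp only [List.append_assoc] at he₂
    exact ⟨_, by omega, .ite_cons he₁
      (.bind (.cons (.var rfl) (.tail he₁)) (he₂.append_env [enc a]))⟩

theorem Computes.listCases {l : α → List β} {b : α → γ} {s : α → β → List β → γ} {T U W : α → ℕ}
    {X : α × β × List β → ℕ} (hl : Computes l T) (hb : Computes b U)
    (hs : Computes (fun p : α × β × List β => s p.1 p.2.1 p.2.2) X)
    (hX : ∀ a x m, l a = x :: m → X (a, x, m) ≤ W a) :
    Computes (fun a => match l a with | [] => b a | x :: m => s a x m)
      fun a => 2 * T a + U a + W a + 10 := by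
  refine ⟨fun a => ?_, fun q => ?_⟩
  · cases hla : l a with
    | nil => have := hb.1 a; simp only [hla]; omega
    | cons x m =>
      have h1 := hs.1 (a, x, m)
      have h2 := hX a x m hla
      simp only [hla] at h1 ⊢
      omega
  obtain ⟨R₁, e₁, h₁⟩ := hl.2 q
  obtain ⟨R₂, e₂, h₂⟩ := hs.2 (q + R₁.length)
  obtain ⟨R₃, e₃, h₃⟩ := hb.2 (q + R₁.length + R₂.length)
  refine ⟨R₁ ++ R₂ ++ R₃, .ite e₁ (.bind (.cons (.var 0) e₁) e₂) e₃, fun Q S hQ a => ?_⟩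
  obtain ⟨s, hs, he₁⟩ := h₁ Q (R₂ ++ R₃ ++ S) hQ a
  obtain ⟨u, hu, he₃⟩ := h₃ (Q ++ R₁ ++ R₂) S (by simp [hQ]; omega) a
  simp only [List.append_assoc] at he₁ he₃ ⊢
  cases hla : l a with
  | nil =>
    rw [hla] at he₁
    exact ⟨s + u + 1, by omega, .ite_nil he₁ he₃⟩
  | cons x m =>
    obtain ⟨t, ht, he₂⟩ := h₂ (Q ++ R₁) (R₃ ++ S) (by simp [hQ]) (a, x, m)
    have h2 := hX a x m hla
    rw [hla] at he₁
    simp only [List.append_assoc] at he₂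
    exact ⟨_, by omega, .ite_cons he₁ (.bind (.cons (.var rfl) he₁) (he₂.append_env [enc a]))⟩

/-- The body of the function number `i` that folds a list: its argument is a pair of a context and
a list, `eb` computes the value for the empty list from the context, and `es` the new value from
the context, the head of the list, and the value for its tail. -/
def foldBody (i : ℕ) (eb es : Term) : Term :=
  .ite (.tail (.var 0))
    (.bind (.cons (.head (.var 0)) (.cons (.head (.tail (.var 0)))
      (.call i (.cons (.head (.var 0)) (.tail (.tail (.var 0))))))) es)
    (.bind (.head (.var 0)) eb)

/-- List recursion. The time depends on bounds `M` for the sizes of the intermediate results and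
`W` for the times of the single steps. -/
theorem Computes.foldr {l : α → List β} {b : α → γ} {s : α → β → γ → γ} {T U W M : α → ℕ}
    {X : α × β × γ → ℕ} (hl : Computes l T) (hb : Computes b U)
    (hs : Computes (fun p : α × β × γ => s p.1 p.2.1 p.2.2) X)
    (hM : ∀ a, sz ((l a).foldr (s a) (b a)) ≤ M a)
    (hW : ∀ a x m, x :: m <:+ l a → X (a, x, m.foldr (s a) (b a)) ≤ W a) :
    Computes (fun a => (l a).foldr (s a) (b a))
      fun a => M a + T a + (sz (l a) + 1) * (W a + U a + 20) := by
  refine ⟨fun a => (hM a).trans (by dsimp only; omega), fun q => ?_⟩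
  obtain ⟨R₁, e₁, h₁⟩ := hl.2 q
  obtain ⟨R₂, e₂, h₂⟩ := hb.2 (q + R₁.length)
  obtain ⟨R₃, e₃, h₃⟩ := hs.2 (q + R₁.length + R₂.length)
  set i := q + R₁.length + R₂.length + R₃.length with hi
  refine ⟨R₁ ++ R₂ ++ R₃ ++ [foldBody i e₂ e₃], .call i (.cons (.var 0) e₁),
    fun Q S hQ a => ?_⟩
  set P := Q ++ (R₁ ++ R₂ ++ R₃ ++ [foldBody i e₂ e₃]) ++ S with hP
  have hPi : P[i]? = some (foldBody i e₂ e₃) := by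
    have : P = (Q ++ R₁ ++ R₂ ++ R₃) ++ (foldBody i e₂ e₃ :: S) := by simp [hP]
    rw [this, List.getElem?_append_right (by simp [hi, hQ]; omega)]
    have : i - (Q ++ R₁ ++ R₂ ++ R₃).length = 0 := by simp [hi, hQ]; omega
    rw [this, List.getElem?_cons_zero]
  have hrec : ∀ m, m <:+ l a → ∃ t ≤ m.length * (W a + 20) + U a + 10,
      Eval P [.cons (enc a) (enc m)] (foldBody i e₂ e₃) (enc (m.foldr (s a) (b a))) t := by
    intro m
    induction m with
    | nil =>
      intro _
      obtain ⟨t, ht, he⟩ := h₂ (Q ++ R₁) (R₃ ++ [foldBody i e₂ e₃] ++ S) (by simp [hQ]) a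
      have hP' : Q ++ R₁ ++ R₂ ++ (R₃ ++ [foldBody i e₂ e₃] ++ S) = P := by simp [hP]
      rw [hP'] at he
      rw [enc_nil]
      refine ⟨_, ?_, .ite_nil (.tail_cons (.var rfl)) (.bind (.head_cons (.var rfl))
        (he.append_env [_]))⟩
      simp only [List.length_nil]
      omega
    | cons x m ih =>
      intro hm
      obtain ⟨t, ht, he⟩ := ih ((List.suffix_cons x m).trans hm)
      obtain ⟨u, hu, he'⟩ := h₃ (Q ++ R₁ ++ R₂) ([foldBody i e₂ e₃] ++ S) (by simp [hQ]; omega)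
        (a, x, m.foldr (s a) (b a))
      have hP' : Q ++ R₁ ++ R₂ ++ R₃ ++ ([foldBody i e₂ e₃] ++ S) = P := by simp [hP]
      rw [hP'] at he'
      rw [enc_cons]
      have h1 := hW a x m hm
      refine ⟨_, ?_, .ite_cons (.tail_cons (.var rfl)) (.bind (.cons (.head_cons (.var rfl))
        (.cons (.head_cons (.tail_cons (.var rfl)))
          (.call (.cons (.head_cons (.var rfl)) (.tail_cons (.tail_cons (.var rfl)))) hPi he)))
        (he'.append_env [_]))⟩
      rw [List.length_cons, Nat.add_mul]
      omega
  obtain ⟨t, ht, he⟩ := hrec (l a) List.suffix_rfl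
  obtain ⟨u, hu, he'⟩ := h₁ Q (R₂ ++ R₃ ++ [foldBody i e₂ e₃] ++ S) hQ a
  have hP' : Q ++ R₁ ++ (R₂ ++ R₃ ++ [foldBody i e₂ e₃] ++ S) = P := by simp [hP]
  rw [hP'] at he'
  refine ⟨_, ?_, .call (.cons (.var rfl) he') hPi he⟩
  have h1 := length_lt_sz (l a)
  have h2 := sz_pos (l a)
  nlinarith [Nat.zero_le (M a), Nat.zero_le (U a), Nat.zero_le (W a)]

/-! ### Polynomial bounds -/

/-- A bound that is polynomial in the size of the representation. -/
def PolyBounded (T : α → ℕ) : Prop :=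
  ∃ C, ∀ a, T a ≤ (sz a + 2) ^ C

theorem PolyBounded.mono {T U : α → ℕ} (hU : PolyBounded U) (h : ∀ a, T a ≤ U a) :
    PolyBounded T := by
  obtain ⟨C, hC⟩ := hU
  exact ⟨C, fun a => (h a).trans (hC a)⟩

theorem PolyBounded.const (k : ℕ) : PolyBounded fun _ : α => k :=
  ⟨k, fun a => Nat.lt_two_pow_self.le.trans (Nat.pow_le_pow_left (by omega) k)⟩

theorem PolyBounded.size : PolyBounded fun a : α => sz a :=
  ⟨1, fun a => by simp⟩

theorem PolyBounded.add {T U : α → ℕ} (hT : PolyBounded T) (hU : PolyBounded U) :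
    PolyBounded fun a => T a + U a := by
  obtain ⟨C, hC⟩ := hT
  obtain ⟨D, hD⟩ := hU
  refine ⟨C + D + 1, fun a => ?_⟩
  have h1 : (sz a + 2) ^ C ≤ (sz a + 2) ^ (C + D) := Nat.pow_le_pow_right (by omega) (by omega)
  have h2 : (sz a + 2) ^ D ≤ (sz a + 2) ^ (C + D) := Nat.pow_le_pow_right (by omega) (by omega)
  have h3 := hC a
  have h4 := hD a
  rw [pow_succ]
  nlinarith

theorem PolyBounded.mul {T U : α → ℕ} (hT : PolyBounded T) (hU : PolyBounded U) :
    PolyBounded fun a => T a * U a := by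
  obtain ⟨C, hC⟩ := hT
  obtain ⟨D, hD⟩ := hU
  exact ⟨C + D, fun a => by rw [pow_add]; exact Nat.mul_le_mul (hC a) (hD a)⟩

theorem PolyBounded.pow {T : α → ℕ} (hT : PolyBounded T) (k : ℕ) :
    PolyBounded fun a => T a ^ k := by
  obtain ⟨C, hC⟩ := hT
  exact ⟨C * k, fun a => by rw [pow_mul]; exact Nat.pow_le_pow_left (hC a) k⟩

/-- Functions computable in polynomial time with results of polynomial size. -/
def PolyTime (f : α → β) : Prop :=
  ∃ T, PolyBounded T ∧ Computes f T

theorem PolyTime.size {f : α → β} (h : PolyTime f) : PolyBounded fun a => sz (f a) := by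
  obtain ⟨T, hT, h⟩ := h
  exact hT.mono h.1

theorem PolyBounded.comp {T : β → ℕ} {f : α → β} (hT : PolyBounded T) (hf : PolyTime f) :
    PolyBounded fun a => T (f a) := by
  obtain ⟨C, hC⟩ := hT
  exact ((hf.size.add (.const 2)).pow C).mono fun a => hC (f a)

/-- A function computed in constant time by a term without calls. -/
theorem PolyTime.of_term {f : α → β} (e : Term) (k : ℕ) (hs : ∀ a, sz (f a) ≤ sz a + k)
    (h : ∀ P a, ∃ t ≤ k, Eval P [enc a] e (enc (f a)) t) : PolyTime f := by
  refine ⟨fun a => sz a + k, PolyBounded.size.add (.const k), .of_term e hs fun P a => ?_⟩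
  obtain ⟨t, ht, he⟩ := h P a
  exact ⟨t, by omega, he⟩

theorem PolyTime.id : PolyTime fun a : α => a :=
  .of_term (.var 0) 1 (fun _ => by omega) fun _ _ => ⟨1, by omega, .var rfl⟩

theorem PolyTime.comp {f : α → β} {g : β → γ} (hg : PolyTime g) (hf : PolyTime f) :
    PolyTime fun a => g (f a) := by
  obtain ⟨U, hU, hg⟩ := hg
  have hf' := hf
  obtain ⟨T, hT, hf⟩ := hf
  exact ⟨_, (hT.add (hU.comp hf')).add (.const 1), hg.comp hf⟩

theorem PolyTime.pair {f : α → β} {g : α → γ} (hf : PolyTime f) (hg : PolyTime g) :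
    PolyTime fun a => (f a, g a) := by
  obtain ⟨T, hT, hf⟩ := hf
  obtain ⟨U, hU, hg⟩ := hg
  exact ⟨_, (hT.add hU).add (.const 1), hf.pair hg⟩

theorem PolyTime.fst {f : α → β × γ} (hf : PolyTime f) : PolyTime fun a => (f a).1 := by
  refine PolyTime.comp (g := fun p : β × γ => p.1) (.of_term (.head (.var 0)) 2 ?_ ?_) hf
  · rintro ⟨b, c⟩
    rw [sz_pair]
    dsimp only
    omega
  · exact fun P p => ⟨2, le_rfl, .head (x := .cons (enc p.1) (enc p.2)) (.var rfl)⟩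

theorem PolyTime.snd {f : α → β × γ} (hf : PolyTime f) : PolyTime fun a => (f a).2 := by
  refine PolyTime.comp (g := fun p : β × γ => p.2) (.of_term (.tail (.var 0)) 2 ?_ ?_) hf
  · rintro ⟨b, c⟩
    rw [sz_pair]
    dsimp only
    omega
  · exact fun P p => ⟨2, le_rfl, .tail (x := .cons (enc p.1) (enc p.2)) (.var rfl)⟩

theorem PolyTime.cons {f : α → β} {g : α → List β} (hf : PolyTime f) (hg : PolyTime g) :
    PolyTime fun a => f a :: g a :=
  PolyTime.comp (g := fun p : β × List β => p.1 :: p.2)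
    (.of_term (.var 0) 1 (fun ⟨b, l⟩ => by simp only [sz_cons, sz_pair]; omega)
      fun _ _ => ⟨1, le_rfl, .var rfl⟩) (hf.pair hg)

theorem PolyTime.nil : PolyTime fun _ : α => ([] : List β) :=
  .of_term .nil 1 (fun a => by rw [sz_nil]; omega) fun _ _ => ⟨1, le_rfl, .nil⟩

theorem PolyTime.none : PolyTime fun _ : α => (none : Option β) :=
  .of_term .nil 1 (fun a => by rw [sz_none]; omega) fun _ _ => ⟨1, le_rfl, .nil⟩

theorem PolyTime.some {f : α → β} (hf : PolyTime f) : PolyTime fun a => some (f a) :=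
  PolyTime.comp (g := fun b : β => Option.some b)
    (.of_term (.cons .nil (.var 0)) 3 (fun a => by rw [sz_some]; omega)
      fun _ _ => ⟨3, le_rfl, .cons .nil (.var rfl)⟩) hf

theorem PolyTime.bool (b : Bool) : PolyTime fun _ : α => b := by
  cases b
  · exact .of_term .nil 1 (fun a => by rw [sz_false]; omega) fun _ _ => ⟨1, le_rfl, .nil⟩
  · exact .of_term (.cons .nil .nil) 3 (fun a => by rw [sz_true]; omega)
      fun _ _ => ⟨3, le_rfl, .cons .nil .nil⟩

theorem PolyTime.unit : PolyTime fun _ : α => () :=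
  .of_term .nil 1 (fun a => by rw [sz_unit]; omega) fun _ _ => ⟨1, le_rfl, .nil⟩

theorem PolyTime.cond {c : α → Bool} {f g : α → β} (hc : PolyTime c) (hf : PolyTime f)
    (hg : PolyTime g) : PolyTime fun a => if c a then f a else g a := by
  obtain ⟨T, hT, hc⟩ := hc
  obtain ⟨U, hU, hf⟩ := hf
  obtain ⟨W, hW, hg⟩ := hg
  exact ⟨_, ((hT.add hU).add hW).add (.const 1), hc.cond hf hg⟩

theorem PolyTime.optionElim {o : α → Option β} {b : α → γ} {s : α → β → γ} (ho : PolyTime o)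
    (hb : PolyTime b) (hs : PolyTime fun p : α × β => s p.1 p.2) :
    PolyTime fun a => (o a).elim (b a) (s a) := by
  have ho' := ho.size
  obtain ⟨T, hT, ho⟩ := ho
  obtain ⟨U, hU, hb⟩ := hb
  obtain ⟨X, ⟨C, hX⟩, hs⟩ := hs
  have hW : PolyBounded fun a => (sz a + sz (o a) + 3) ^ C :=
    ((PolyBounded.size.add ho').add (.const 3)).pow C
  refine ⟨_, (((PolyBounded.const 2).mul hT).add hU |>.add hW).add (.const 10),
    ho.optionElim hb hs fun a x hx => (hX _).trans (Nat.pow_le_pow_left ?_ C)⟩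
  rw [Option.mem_def.mp hx, sz_some, sz_pair]
  omega

theorem PolyTime.listCases {l : α → List β} {b : α → γ} {s : α → β → List β → γ}
    (hl : PolyTime l) (hb : PolyTime b)
    (hs : PolyTime fun p : α × β × List β => s p.1 p.2.1 p.2.2) :
    PolyTime fun a => match l a with | [] => b a | x :: m => s a x m := by
  have hl' := hl.size
  obtain ⟨T, hT, hl⟩ := hl
  obtain ⟨U, hU, hb⟩ := hb
  obtain ⟨X, ⟨C, hX⟩, hs⟩ := hs
  have hW : PolyBounded fun a => (sz a + sz (l a) + 3) ^ C :=
    ((PolyBounded.size.add hl').add (.const 3)).pow C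
  refine ⟨_, (((PolyBounded.const 2).mul hT).add hU |>.add hW).add (.const 10),
    hl.listCases hb hs fun a x m hx => (hX _).trans (Nat.pow_le_pow_left ?_ C)⟩
  rw [hx, sz_cons, sz_pair, sz_pair]

/-- List recursion with intermediate results of polynomial size. -/
theorem PolyTime.foldr {l : α → List β} {b : α → γ} {s : α → β → γ → γ} {M : α → ℕ}
    (hl : PolyTime l) (hb : PolyTime b) (hs : PolyTime fun p : α × β × γ => s p.1 p.2.1 p.2.2)
    (hM : PolyBounded M) (h : ∀ a m, m <:+ l a → sz (m.foldr (s a) (b a)) ≤ M a) :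
    PolyTime fun a => (l a).foldr (s a) (b a) := by
  have hl' := hl.size
  obtain ⟨T, hT, hl⟩ := hl
  obtain ⟨U, hU, hb⟩ := hb
  obtain ⟨X, ⟨C, hX⟩, hs⟩ := hs
  have hW : PolyBounded fun a => (sz a + sz (l a) + M a + 4) ^ C :=
    (((PolyBounded.size.add hl').add hM).add (.const 4)).pow C
  refine ⟨_, (hM.add hT).add ((hl'.add (.const 1)).mul ((hW.add hU).add (.const 20))),
    hl.foldr hb hs (fun a => h a _ List.suffix_rfl)
      fun a x m hx => (hX _).trans (Nat.pow_le_pow_left ?_ C)⟩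
  have h1 := h a m ((List.suffix_cons x m).trans hx)
  have h2 := sz_le_of_mem (hx.subset List.mem_cons_self)
  simp only [sz_pair]
  omega

end Resources

/-! ### Polynomial-time list functions -/

section Nub

variable {δ : Type} [DecidableEq δ]

/-- The list without repetitions that has the same members. -/
def nub (l : List δ) : List δ :=
  l.foldr (fun x acc => if acc.any fun y => decide (y = x) then acc else x :: acc) []

theorem nub_cons (x : δ) (l : List δ) :
    nub (x :: l) = if x ∈ nub l then nub l else x :: nub l := by
  have : (nub l).any (fun y => decide (y = x)) = decide (x ∈ nub l) := by
    rw [Bool.eq_iff_iff]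
    simp
  change (if (nub l).any (fun y => decide (y = x)) then nub l else x :: nub l) = _
  rw [this]
  simp

@[simp] theorem mem_nub {x : δ} {l : List δ} : x ∈ nub l ↔ x ∈ l := by
  induction l with
  | nil => simp [nub]
  | cons y l ih =>
    rw [nub_cons]
    split_ifs with h
    · rw [List.mem_cons, ← ih]
      constructor
      · exact Or.inr
      · rintro (rfl | h')
        · exact h
        · exact h'
    · rw [List.mem_cons, List.mem_cons, ih]

theorem nodup_nub (l : List δ) : (nub l).Nodup := by
  induction l with
  | nil => simp [nub]
  | cons y l ih =>
    rw [nub_cons]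
    split_ifs with h
    · exact ih
    · exact List.nodup_cons.mpr ⟨h, ih⟩

theorem nub_sublist (l : List δ) : (nub l).Sublist l := by
  induction l with
  | nil => simp [nub]
  | cons y l ih =>
    rw [nub_cons]
    split_ifs with h
    · exact ih.cons y
    · exact ih.cons_cons y

theorem nub_map {ε : Type} [DecidableEq ε] {f : δ → ε}
    (hf : Function.Injective f) (l : List δ) : nub (l.map f) = (nub l).map f := by
  induction l with
  | nil => rfl
  | cons y l ih =>
    rw [List.map_cons, nub_cons, nub_cons, ih, apply_ite (List.map f)]
    simp only [List.mem_map_of_injective hf, List.map_cons]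

end Nub

section ListFunctions

open Enc

variable {α β γ : Type} [Enc α] [Enc β] [Enc γ]

theorem PolyTime.congr {f g : α → β} (hf : PolyTime f) (h : ∀ a, f a = g a) : PolyTime g :=
  funext h ▸ hf

theorem PolyTime.not {f : α → Bool} (hf : PolyTime f) : PolyTime fun a => !f a :=
  (hf.cond (.bool false) (.bool true)).congr fun a => by cases f a <;> rfl

theorem PolyTime.and {f g : α → Bool} (hf : PolyTime f) (hg : PolyTime g) :
    PolyTime fun a => f a && g a :=
  (hf.cond hg (.bool false)).congr fun a => by cases f a <;> rfl

theorem PolyTime.or {f g : α → Bool} (hf : PolyTime f) (hg : PolyTime g) :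
    PolyTime fun a => f a || g a :=
  (hf.cond (.bool true) hg).congr fun a => by cases f a <;> rfl

theorem PolyTime.beq {f g : α → Bool} (hf : PolyTime f) (hg : PolyTime g) :
    PolyTime fun a => f a == g a :=
  (hf.cond hg hg.not).congr fun a => by cases f a <;> cases g a <;> rfl

theorem PolyTime.append {f g : α → List β} (hf : PolyTime f) (hg : PolyTime g) :
    PolyTime fun a => f a ++ g a := by
  refine (PolyTime.foldr (s := fun _ x acc => x :: acc) hf hg
    (PolyTime.cons PolyTime.id.snd.fst PolyTime.id.snd.snd) (hf.size.add hg.size)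
    fun a m hm => ?_).congr fun a => by simp
  have h1 := sz_le_of_sublist hm.sublist
  have h2 := sz_append_le m (g a)
  have h3 : m.foldr (fun x acc => x :: acc) (g a) = m ++ g a := by simp
  rw [h3]
  omega

theorem PolyTime.map {l : α → List β} {f : α → β → γ} (hl : PolyTime l)
    (hf : PolyTime fun p : α × β => f p.1 p.2) : PolyTime fun a => (l a).map (f a) := by
  obtain ⟨C, hC⟩ := hf.size
  have hM : PolyBounded fun a => sz (l a) * ((sz a + sz (l a) + 3) ^ C + 1) + 1 :=
    (hl.size.mul ((((PolyBounded.size.add hl.size).add (.const 3)).pow C).add (.const 1))).add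
      (.const 1)
  refine (PolyTime.foldr (s := fun a x acc => f a x :: acc) hl .nil
    (PolyTime.cons (hf.comp (PolyTime.id.fst.pair PolyTime.id.snd.fst)) PolyTime.id.snd.snd) hM
    fun a m hm => ?_).congr fun a => by simp
  simp only [List.foldr_cons_eq_append, List.append_nil]
  refine (sz_list_le (m := (sz a + sz (l a) + 3) ^ C) fun c hc => ?_).trans ?_
  · obtain ⟨x, hx, rfl⟩ := List.mem_map.mp hc
    refine (hC (a, x)).trans (Nat.pow_le_pow_left ?_ C)
    have := sz_le_of_mem (hm.subset hx)
    rw [sz_pair]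
    omega
  · rw [List.length_map]
    gcongr
    exact hm.length_le.trans (length_lt_sz _).le

theorem PolyTime.filter {l : α → List β} {p : α → β → Bool} (hl : PolyTime l)
    (hp : PolyTime fun x : α × β => p x.1 x.2) : PolyTime fun a => (l a).filter (p a) := by
  have heq : ∀ a (m : List β),
      m.foldr (fun x acc => if p a x then x :: acc else acc) [] = m.filter (p a) := by
    intro a m
    induction m with
    | nil => rfl
    | cons x m ih => rw [List.foldr_cons, ih, List.filter_cons]
  refine (PolyTime.foldr (s := fun a x acc => if p a x then x :: acc else acc) hl .nil
    (PolyTime.cond (hp.comp (PolyTime.id.fst.pair PolyTime.id.snd.fst))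
      (PolyTime.cons PolyTime.id.snd.fst PolyTime.id.snd.snd) PolyTime.id.snd.snd) hl.size
    fun a m hm => ?_).congr fun a => heq a (l a)
  rw [heq]
  exact sz_le_of_sublist (List.filter_sublist.trans hm.sublist)

theorem sz_flatten_le (L : List (List β)) : sz L.flatten ≤ sz L := by
  induction L with
  | nil => simp
  | cons l L ih =>
    have := sz_append_le l L.flatten
    rw [List.flatten_cons, sz_cons]
    omega

theorem PolyTime.flatten {L : α → List (List β)} (hL : PolyTime L) :
    PolyTime fun a => (L a).flatten := by
  have heq : ∀ (m : List (List β)), m.foldr (fun x acc => x ++ acc) [] = m.flatten := by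
    intro m
    induction m with
    | nil => rfl
    | cons x m ih => rw [List.foldr_cons, ih, List.flatten_cons]
  refine (PolyTime.foldr (s := fun _ x acc => x ++ acc) hL .nil
    (PolyTime.append PolyTime.id.snd.fst PolyTime.id.snd.snd) hL.size fun a m hm => ?_).congr
    fun a => heq (L a)
  rw [heq]
  exact (sz_flatten_le m).trans (sz_le_of_sublist hm.sublist)

theorem PolyTime.flatMap {l : α → List β} {f : α → β → List γ} (hl : PolyTime l)
    (hf : PolyTime fun p : α × β => f p.1 p.2) : PolyTime fun a => (l a).flatMap (f a) :=
  (hl.map hf).flatten.congr fun a => by rw [List.flatMap_def]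

theorem PolyTime.any {l : α → List β} {p : α → β → Bool} (hl : PolyTime l)
    (hp : PolyTime fun x : α × β => p x.1 x.2) : PolyTime fun a => (l a).any (p a) := by
  refine (PolyTime.foldr (s := fun a x acc => if p a x then true else acc) hl (.bool false)
    (PolyTime.cond (hp.comp (PolyTime.id.fst.pair PolyTime.id.snd.fst)) (.bool true)
      PolyTime.id.snd.snd) (.const 3) fun a m hm => sz_bool_le _).congr fun a => ?_
  induction l a with
  | nil => rfl
  | cons x m ih => rw [List.foldr_cons, ih, List.any_cons]; cases p a x <;> simp

theorem PolyTime.tail {l : α → List β} (hl : PolyTime l) : PolyTime fun a => (l a).tail :=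
  (hl.listCases (s := fun _ _ m => m) .nil PolyTime.id.snd.snd).congr fun a => by
    cases l a <;> rfl

theorem PolyTime.head? {l : α → List β} (hl : PolyTime l) : PolyTime fun a => (l a).head? :=
  (hl.listCases (s := fun _ x _ => Option.some x) .none (PolyTime.some PolyTime.id.snd.fst)).congr
    fun a => by cases l a <;> rfl

theorem sz_reverse (l : List β) : sz l.reverse = sz l := by
  have h : ∀ l l' : List β, sz (l ++ l') + 1 = sz l + sz l' := by
    intro l l'
    induction l with
    | nil => simp only [List.nil_append, sz_nil]; omega
    | cons x l ih => simp only [List.cons_append, sz_cons]; omega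
  induction l with
  | nil => rfl
  | cons x l ih =>
    have h1 := h l.reverse [x]
    rw [List.reverse_cons, sz_cons]
    rw [sz_cons, sz_nil] at h1
    omega

theorem PolyTime.reverse {l : α → List β} (hl : PolyTime l) :
    PolyTime fun a => (l a).reverse := by
  have heq : ∀ m : List β, m.foldr (fun x acc => acc ++ [x]) [] = m.reverse := by
    intro m
    induction m with
    | nil => rfl
    | cons x m ih => rw [List.foldr_cons, ih, List.reverse_cons]
  refine (PolyTime.foldr (s := fun _ x acc => acc ++ [x]) hl .nil
    (PolyTime.append PolyTime.id.snd.snd (PolyTime.cons PolyTime.id.snd.fst .nil)) hl.size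
    fun a m hm => ?_).congr fun a => heq (l a)
  rw [heq, sz_reverse]
  exact sz_le_of_sublist hm.sublist

/-- Iteration of a function, the number of rounds being the length of a list. -/
theorem PolyTime.iterate {l : α → List β} {b : α → γ} {f : α → γ → γ} {M : α → ℕ}
    (hl : PolyTime l) (hb : PolyTime b) (hf : PolyTime fun p : α × γ => f p.1 p.2)
    (hM : PolyBounded M) (h : ∀ a, ∀ j ≤ (l a).length, sz ((f a)^[j] (b a)) ≤ M a) :
    PolyTime fun a => (f a)^[(l a).length] (b a) := by
  have heq : ∀ a (m : List β), m.foldr (fun _ acc => f a acc) (b a) = (f a)^[m.length] (b a) := by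
    intro a m
    induction m with
    | nil => rfl
    | cons x m ih => rw [List.foldr_cons, ih, List.length_cons, Function.iterate_succ_apply']
  refine (PolyTime.foldr (s := fun a _ acc => f a acc) hl hb
    (hf.comp (PolyTime.id.fst.pair PolyTime.id.snd.snd)) hM fun a m hm => ?_).congr
    fun a => heq a (l a)
  rw [heq]
  exact h a _ hm.length_le

/-- Comparison of the lengths of two lists. -/
theorem PolyTime.lengthLE {f : α → List β} {g : α → List γ} (hf : PolyTime f) (hg : PolyTime g) :
    PolyTime fun a => decide ((f a).length ≤ (g a).length) := by
  -- drop as many elements as `f a` has from a list with one element more than `g a`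
  let u : α → List Unit := fun a => () :: (g a).map fun _ => ()
  have hu : PolyTime u := PolyTime.cons .unit (hg.map (f := fun _ _ => ()) .unit)
  have hlen : ∀ a, (u a).length = (g a).length + 1 := fun a => by simp [u]
  have h := PolyTime.iterate (f := fun _ l => l.tail) hf hu (PolyTime.id.snd.tail) hu.size
    fun a j _ => by
      rw [List.tail_iterate]
      exact sz_le_of_sublist (List.drop_sublist _ _)
  refine (h.listCases (s := fun _ _ _ => true) (.bool false) (.bool true)).congr fun a => ?_
  rw [List.tail_iterate]
  have h1 := List.length_drop (i := (f a).length) (l := u a)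
  rw [hlen] at h1
  split
  · next h2 =>
    rw [h2, List.length_nil] at h1
    symm
    rw [decide_eq_false_iff_not]
    omega
  · next h2 =>
    rw [h2, List.length_cons] at h1
    symm
    rw [decide_eq_true_iff]
    omega

theorem polyTime_nub [DecidableEq β] (heq : PolyTime fun p : β × β => decide (p.1 = p.2))
    {l : α → List β} (hl : PolyTime l) : PolyTime fun a => nub (l a) := by
  refine PolyTime.foldr
    (s := fun _ x acc => if acc.any fun y => decide (y = x) then acc else x :: acc) hl .nil
    (PolyTime.cond
      (PolyTime.any (l := fun p : α × β × List β => p.2.2) (p := fun p y => decide (y = p.2.1))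
        PolyTime.id.snd.snd (heq.comp (PolyTime.id.snd.pair PolyTime.id.fst.snd.fst)))
      PolyTime.id.snd.snd (PolyTime.cons PolyTime.id.snd.fst PolyTime.id.snd.snd))
    hl.size fun a m hm => ?_
  exact (sz_le_of_sublist (nub_sublist m)).trans (sz_le_of_sublist hm.sublist)

/-! ### Bit vectors -/

/-- Bitwise operation on two vectors of the same length, by recursion on the first vector only: the
second one is consumed from its end. -/
def vzip (op : Bool → Bool → Bool) (l₁ l₂ : List Bool) : List Bool :=
  (l₁.foldr (fun x st => (st.1.tail, op x (st.1.head?.getD false) :: st.2))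
    (l₂.reverse, ([] : List Bool))).2

theorem vzip_map {ι : Type} (op : Bool → Bool → Bool) (f g : ι → Bool) (l : List ι) :
    vzip op (l.map f) (l.map g) = l.map fun i => op (f i) (g i) := by
  have h : ∀ (l k : List ι),
      (l.map f).foldr (fun x st => (st.1.tail, op x (st.1.head?.getD false) :: st.2))
        (((k ++ l).map g).reverse, ([] : List Bool))
      = ((k.map g).reverse, l.map fun i => op (f i) (g i)) := by
    intro l
    induction l with
    | nil => intro k; simp
    | cons i l ih =>
      intro k
      have := ih (k ++ [i])
      rw [List.append_assoc, List.singleton_append] at this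
      rw [List.map_cons, List.foldr_cons, this]
      simp
  have := h l []
  rw [List.nil_append] at this
  rw [vzip, this]

theorem polyTime_vzip {op : Bool → Bool → Bool} (hop : PolyTime fun p : Bool × Bool => op p.1 p.2)
    {f g : α → List Bool} (hf : PolyTime f) (hg : PolyTime g) :
    PolyTime fun a => vzip op (f a) (g a) := by
  have hM : PolyBounded fun a => sz (g a) + (sz (f a) * 4 + 1) + 1 :=
    (hg.size.add ((hf.size.mul (.const 4)).add (.const 1))).add (.const 1)
  refine PolyTime.snd (PolyTime.foldr
    (s := fun _ x st => (st.1.tail, op x (st.1.head?.getD false) :: st.2)) hf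
    (hg.reverse.pair .nil) (PolyTime.pair PolyTime.id.snd.snd.fst.tail
      (PolyTime.cons (hop.comp (PolyTime.id.snd.fst.pair ?_)) PolyTime.id.snd.snd.snd)) hM
    fun a m hm => ?_)
  · exact ((PolyTime.head? PolyTime.id.snd.snd.fst).optionElim (s := fun _ x => x) (.bool false)
      PolyTime.id.snd).congr fun a => by cases a.2.2.1 <;> rfl
  · have h1 : sz (m.foldr (fun x (st : List Bool × List Bool) =>
        (st.1.tail, op x (st.1.head?.getD false) :: st.2)) ((g a).reverse, [])).1 ≤ sz (g a) ∧
        (m.foldr (fun x (st : List Bool × List Bool) =>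
        (st.1.tail, op x (st.1.head?.getD false) :: st.2)) ((g a).reverse, [])).2.length
          = m.length := by
      clear hm
      induction m with
      | nil => exact ⟨(sz_reverse _).le, rfl⟩
      | cons x m ih =>
        exact ⟨(sz_le_of_sublist (List.tail_sublist _)).trans ih.1, congrArg (· + 1) ih.2⟩
    generalize m.foldr _ _ = st at h1 ⊢
    have h2 := sz_list_le (l := st.2) fun b _ => sz_bool_le b
    have h3 := hm.length_le.trans (length_lt_sz _).le
    have h4 : sz st = sz st.1 + sz st.2 + 1 := rfl
    omega

/-- Equality of bit vectors: equal lengths, and equal bits. -/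
theorem polyTime_eqBits : PolyTime fun p : List Bool × List Bool => decide (p.1 = p.2) := by
  have h : PolyTime fun p : List Bool × List Bool =>
      (decide (p.1.length ≤ p.2.length) && decide (p.2.length ≤ p.1.length)) &&
        !(vzip (fun x y => x == y) p.1 p.2).any fun b => !b :=
    ((PolyTime.id.fst.lengthLE PolyTime.id.snd).and
      (PolyTime.id.snd.lengthLE PolyTime.id.fst)).and
      (PolyTime.any (p := fun _ b => !b)
        (polyTime_vzip (PolyTime.id.fst.beq PolyTime.id.snd) PolyTime.id.fst PolyTime.id.snd)
        PolyTime.id.snd.not).not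
  refine h.congr fun ⟨x, y⟩ => ?_
  dsimp only
  by_cases hlen : x.length = y.length
  · have hx : ∀ z : List Bool, z = (List.range z.length).map fun i => z.getD i false := by
      intro z
      apply List.ext_getElem <;> simp +contextual
    have hz : vzip (fun x y => x == y) x y
        = (List.range x.length).map fun i => x.getD i false == y.getD i false := by
      rw [← vzip_map]
      congr 1
      · exact hx x
      · rw [hlen]
        exact hx y
    rw [hz, Bool.eq_iff_iff]
    simp only [hlen, le_refl, decide_true, Bool.and_self, Bool.true_and, Bool.not_eq_true',
      List.any_eq_false, List.mem_map, List.mem_range, decide_eq_true_eq,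
      forall_exists_index, and_imp, forall_apply_eq_imp_iff₂]
    constructor
    · intro h
      refine List.ext_getElem hlen fun i h1 h2 => ?_
      simpa [h1, h2] using h i h2
    · rintro rfl i
      simp
  · have hne : x ≠ y := fun h => hlen (h ▸ rfl)
    rw [decide_eq_false hne]
    rcases Nat.lt_or_gt_of_ne hlen with h | h
    · rw [decide_eq_false (p := y.length ≤ x.length) (by omega)]
      simp
    · rw [decide_eq_false (p := x.length ≤ y.length) (by omega)]
      simp

/-! ### Logarithms -/

/-- A list with half as many elements, rounded down. -/
def half (l : List Unit) : List Unit :=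
  (l.foldr (fun _ st => if st.1 then (false, () :: st.2) else (true, st.2))
    (false, ([] : List Unit))).2

theorem half_state (l : List Unit) :
    (l.foldr (fun _ (st : Bool × List Unit) => if st.1 then (false, () :: st.2) else (true, st.2))
      (false, [])).2.length = l.length / 2 ∧
    (l.foldr (fun _ (st : Bool × List Unit) => if st.1 then (false, () :: st.2) else (true, st.2))
      (false, [])).1 = decide (l.length % 2 = 1) := by
  induction l with
  | nil => simp
  | cons x l ih =>
    obtain ⟨h1, h2⟩ := ih
    rw [List.foldr_cons]
    by_cases h : l.length % 2 = 1
    · rw [h2, decide_eq_true h, if_pos rfl]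
      refine ⟨?_, ?_⟩
      · rw [List.length_cons, h1, List.length_cons]; omega
      · rw [List.length_cons, eq_comm, decide_eq_false_iff_not]; omega
    · rw [h2, decide_eq_false h]
      refine ⟨?_, ?_⟩
      · rw [List.length_cons]
        simp only [Bool.false_eq_true, if_false]
        omega
      · rw [List.length_cons]
        simp only [Bool.false_eq_true, if_false]
        rw [eq_comm, decide_eq_true_iff]
        omega

theorem length_half (l : List Unit) : (half l).length = l.length / 2 :=
  (half_state l).1

theorem sz_list_unit (l : List Unit) : sz l = 2 * l.length + 1 := by
  induction l with
  | nil => rfl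
  | cons x l ih => rw [sz_cons, sz_unit, List.length_cons]; omega

theorem polyTime_half {f : α → List Unit} (hf : PolyTime f) :
    PolyTime fun a => half (f a) := by
  refine PolyTime.snd (PolyTime.foldr
    (s := fun _ _ (st : Bool × List Unit) => if st.1 then (false, () :: st.2) else (true, st.2))
    hf ((PolyTime.bool false).pair .nil)
    (PolyTime.cond PolyTime.id.snd.snd.fst
      ((PolyTime.bool false).pair (PolyTime.cons .unit PolyTime.id.snd.snd.snd))
      ((PolyTime.bool true).pair PolyTime.id.snd.snd.snd))
    (hf.size.add (.const 5)) fun a m hm => ?_)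
  have h1 := (half_state m).1
  have h2 := sz_le_of_sublist hm.sublist
  rw [sz_list_unit] at h2
  generalize m.foldr _ _ = st at h1 ⊢
  have h3 : sz st = sz st.1 + sz st.2 + 1 := rfl
  have h4 := sz_bool_le st.1
  rw [sz_list_unit st.2] at h3
  omega

/-- One round of the computation of a binary logarithm: halve the first list and count, as long as
it has at least two elements. -/
def logStep (st : List Unit × List Unit) : List Unit × List Unit :=
  if decide ([(), ()].length ≤ st.1.length) then (half st.1, () :: st.2) else st

theorem logStep_iterate (j : ℕ) (st : List Unit × List Unit) :
    (logStep^[j] st).1.length ≤ st.1.length ∧ (logStep^[j] st).2.length ≤ st.2.length + j ∧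
      (st.1.length ≤ j + 1 →
        (logStep^[j] st).2.length = st.2.length + Nat.log 2 st.1.length) := by
  induction j generalizing st with
  | zero =>
    refine ⟨le_rfl, le_rfl, fun h => ?_⟩
    rw [Nat.log_of_lt (by omega)]
    rfl
  | succ j ih =>
    rw [Function.iterate_succ_apply]
    obtain ⟨h1, h2, h3⟩ := ih (logStep st)
    by_cases h : 2 ≤ st.1.length
    · have hs : logStep st = (half st.1, () :: st.2) := by simp [logStep, h]
      rw [hs] at h1 h2 h3 ⊢
      simp only [length_half, List.length_cons] at h1 h2 h3
      refine ⟨by omega, by omega, fun h4 => ?_⟩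
      rw [h3 (by omega), Nat.log_of_one_lt_of_le (by norm_num) h]
      omega
    · have hs : logStep st = st := by simp [logStep, h]
      rw [hs] at h1 h2 h3 ⊢
      refine ⟨h1, by omega, fun h4 => h3 ?_⟩
      omega

/-- A list whose length is the binary logarithm of the length of the given list. -/
def logList {δ : Type} (l : List δ) : List Unit :=
  (logStep^[l.length] (l.map fun _ => (), [])).2

theorem length_logList {δ : Type} (l : List δ) : (logList l).length = Nat.log 2 l.length := by
  rw [logList, (logStep_iterate _ _).2.2 (by simp)]
  simp

theorem polyTime_logList {l : α → List β} (hl : PolyTime l) :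
    PolyTime fun a => logList (l a) := by
  have hM : PolyBounded fun a => (2 * sz (l a) + 1) + (2 * sz (l a) + 1) + 1 :=
    ((((PolyBounded.const 2).mul hl.size).add (.const 1)).add
      (((PolyBounded.const 2).mul hl.size).add (.const 1))).add (.const 1)
  refine PolyTime.snd (PolyTime.iterate (f := fun _ => logStep) hl
    ((hl.map (f := fun _ _ => ()) .unit).pair .nil) ?_ hM fun a j hj => ?_)
  · exact PolyTime.cond (PolyTime.lengthLE (PolyTime.cons .unit (PolyTime.cons .unit .nil))
      PolyTime.id.snd.fst) ((polyTime_half PolyTime.id.snd.fst).pair (PolyTime.cons .unit PolyTime.id.snd.snd))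
      PolyTime.id.snd
  · obtain ⟨h1, h2, -⟩ := logStep_iterate j ((l a).map fun _ => (), [])
    have h3 := (length_lt_sz (l a)).le
    have h4 : ∀ st : List Unit × List Unit, sz st = sz st.1 + sz st.2 + 1 := fun _ => rfl
    rw [h4, sz_list_unit, sz_list_unit]
    simp only [List.length_map, List.length_nil] at h1 h2
    omega

end ListFunctions

/-! ### The algorithm on bit vectors -/

section Algorithm

open Enc

/-- Bit vectors; vertices are given by the characteristic vectors of singletons. -/
abbrev Bits := List Bool

/-- The intersection of two vertex sets. -/
def inter (X Y : Bits) : Bits :=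
  vzip (fun x y => x && y) X Y

/-- Whether two vertex sets have a common member. -/
def meets (X Y : Bits) : Bool :=
  (inter X Y).any fun b => b

/-- The neighbourhood of the vertex set `X`, given the adjacency matrix `A`. -/
def neighbours (A : List Bits) (X : Bits) : Bits :=
  A.map fun row => meets row X

/-- Add to the vertex set `X` its neighbours in `S`. -/
def expand (A : List Bits) (S X : Bits) : Bits :=
  inter (vzip (fun x y => x || y) X (neighbours A X)) S

/-- The component of `v` in the graph induced by `S`. -/
def component (A : List Bits) (S v : Bits) : Bits :=
  (expand A S)^[A.length] (inter v S)

/-- The rows of an identity matrix: the list of all vertices. The recursion carries along a zero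
vector of the current length. -/
def unitVectors (A : List Bits) : List Bits :=
  (A.foldr (fun _ st => (false :: st.1, (true :: st.1) :: st.2.map fun r => false :: r))
    (([] : Bits), ([] : List Bits))).2

/-- The members of `S` among the vertices `E`. -/
def members (E : List Bits) (S : Bits) : List Bits :=
  E.filter fun v => meets v S

/-- The set `S` without the vertex `v`. -/
def remove (S v : Bits) : Bits :=
  vzip (fun x y => x && !y) S v

/-- The components of the graph induced by `S`. -/
def componentList (A E : List Bits) (S : Bits) : List Bits :=
  nub ((members E S).map (component A S))

/-- The concatenation of labelings given as lists of pairs; it fails if one of them is missing. -/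
def glue {δ : Type} (p : List δ) (os : List (Option (List δ))) : Option (List δ) :=
  os.foldr (fun o acc => acc.elim none fun y => o.elim none fun x => some (x ++ y)) (some p)

/-- A shortest list among those that are not missing. -/
def shortest {δ : Type} (cs : List (Option (List δ))) : Option (List δ) :=
  cs.foldr (fun o acc => o.elim acc fun x => acc.elim (some x) fun y =>
    if decide (x.length ≤ y.length) then some x else some y) none

/-- Labelings, as lists of pairs of a vertex and one of its hubs. -/
abbrev Pairs := List (Bits × Bits)

/-- The labeling stored for `C` in a table. -/
def lookup (T : List (Bits × Option Pairs)) (C : Bits) : Option Pairs :=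
  ((T.filter fun e => decide (e.1 = C)).head?).elim none fun e => e.2

/-- The labeling of `S` with root `r`, when the labelings of the components are taken from the
table `T`. -/
def labelingAt (A E : List Bits) (T : List (Bits × Option Pairs)) (S r : Bits) : Option Pairs :=
  glue ((members E S).map fun u => (u, r)) ((componentList A E (remove S r)).map (lookup T))

/-- One round of the dynamic program: each entry is recomputed from the current table. -/
def nextTable (A E : List Bits) (T : List (Bits × Option Pairs)) : List (Bits × Option Pairs) :=
  T.map fun e => (e.1, shortest ((members E e.1).map (labelingAt A E T e.1)))

/-- All sets that arise from one of the sets in `L` by removing at most one vertex. -/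
def removals (E : List Bits) (L : List Bits) : List Bits :=
  L ++ L.flatMap fun S => E.map (remove S)

/-- The components of the graphs induced by the sets in `L`. -/
def subtreeList (A E L : List Bits) : List Bits :=
  nub (L.flatMap (componentList A E))

/-- The table after `n` rounds, starting without any labeling. -/
def finalTable (A E L : List Bits) : List (Bits × Option Pairs) :=
  (nextTable A E)^[A.length] ((subtreeList A E L).map fun S => (S, none))

/-- Replacing each labeling in the table by its cost. -/
def costTable (T : List (Bits × Option Pairs)) : List (Bits × Option (List Unit)) :=
  T.map fun e => (e.1, e.2.elim none fun P => some (P.map fun _ => ()))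

/-- The labels of the whole tree. -/
def finalLabels (A E : List Bits) (T : List (Bits × Option Pairs)) : List Bits :=
  E.map fun u => E.map fun w => (lookup T (A.map fun _ => true)).elim false fun P =>
    P.any fun p => decide (p.1 = u) && decide (p.2 = w)

/-! ### Running times of the parts of the algorithm -/

variable {α : Type} [Enc α]

theorem PolyTime.eq {f g : α → Bits} (hf : PolyTime f) (hg : PolyTime g) :
    PolyTime fun a => decide (f a = g a) :=
  PolyTime.comp polyTime_eqBits (hf.pair hg)

theorem polyTime_inter {f g : α → Bits} (hf : PolyTime f) (hg : PolyTime g) :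
    PolyTime fun a => inter (f a) (g a) :=
  polyTime_vzip (PolyTime.id.fst.and PolyTime.id.snd) hf hg

theorem polyTime_meets {f g : α → Bits} (hf : PolyTime f) (hg : PolyTime g) :
    PolyTime fun a => meets (f a) (g a) :=
  PolyTime.any (p := fun _ b => b) (polyTime_inter hf hg) PolyTime.id.snd

theorem polyTime_neighbours {A : α → List Bits} {X : α → Bits} (hA : PolyTime A)
    (hX : PolyTime X) : PolyTime fun a => neighbours (A a) (X a) :=
  PolyTime.map (f := fun a row => meets row (X a)) hA
    (polyTime_meets PolyTime.id.snd (hX.comp PolyTime.id.fst))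

theorem polyTime_expand {A : α → List Bits} {S X : α → Bits} (hA : PolyTime A) (hS : PolyTime S)
    (hX : PolyTime X) : PolyTime fun a => expand (A a) (S a) (X a) :=
  polyTime_inter (polyTime_vzip (PolyTime.id.fst.or PolyTime.id.snd) hX (polyTime_neighbours hA hX)) hS

theorem length_vzip (op : Bool → Bool → Bool) (l₁ l₂ : Bits) :
    (vzip op l₁ l₂).length = l₁.length := by
  unfold vzip
  generalize l₂.reverse = m
  induction l₁ with
  | nil => rfl
  | cons x l ih => rw [List.foldr_cons, List.length_cons, List.length_cons, ih]

theorem sz_bits_le (l : Bits) : sz l ≤ 4 * l.length + 1 := by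
  have := sz_list_le (l := l) fun b _ => sz_bool_le b
  omega

theorem polyTime_component {A : α → List Bits} {S v : α → Bits} (hA : PolyTime A)
    (hS : PolyTime S) (hv : PolyTime v) : PolyTime fun a => component (A a) (S a) (v a) := by
  have hM : PolyBounded fun a => 4 * sz (v a) + 1 :=
    ((PolyBounded.const 4).mul hv.size).add (.const 1)
  refine PolyTime.iterate (f := fun a => expand (A a) (S a)) hA (polyTime_inter hv hS)
    (polyTime_expand (hA.comp PolyTime.id.fst) (hS.comp PolyTime.id.fst) PolyTime.id.snd) hM
    fun a j _ => ?_
  have h : ∀ j, ((expand (A a) (S a))^[j]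
      (inter (v a) (S a))).length = (v a).length := by
    intro j
    induction j with
    | zero => exact length_vzip _ _ _
    | succ j ih =>
      rw [Function.iterate_succ_apply', expand, inter, length_vzip, length_vzip, ih]
  have h1 := sz_bits_le ((expand (A a) (S a))^[j]
      (inter (v a) (S a)))
  have h2 := length_lt_sz (v a)
  rw [h j] at h1
  omega

theorem unitVectors_state {δ : Type} (l : List δ) :
    l.foldr (fun _ st => (false :: st.1, (true :: st.1) :: st.2.map fun r => false :: r))
      (([] : Bits), ([] : List Bits))
    = (List.replicate l.length false, (List.finRange l.length).map fun i =>
        (List.finRange l.length).map fun j => decide (j = i)) := by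
  induction l with
  | nil => rfl
  | cons x l ih =>
    rw [List.foldr_cons, ih]
    refine Prod.ext (by simp [List.replicate_succ]) ?_
    simp only [List.length_cons, List.finRange_succ, List.map_cons, List.map_map]
    refine congrArg₂ _ ?_ (List.map_congr_left fun i _ => ?_)
    · refine congrArg₂ _ (by simp) ?_
      apply List.ext_getElem
      · simp
      · intro i h1 h2
        simp
    · refine congrArg₂ _ ?_ (List.map_congr_left fun j _ => ?_)
      · symm
        rw [decide_eq_false_iff_not]
        exact (Fin.succ_ne_zero i).symm
      · simp

theorem unitVectors_eq (A : List Bits) :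
    unitVectors A = (List.finRange A.length).map fun i =>
      (List.finRange A.length).map fun j => decide (j = i) := by
  rw [unitVectors, unitVectors_state]

theorem polyTime_unitVectors {A : α → List Bits} (hA : PolyTime A) :
    PolyTime fun a => unitVectors (A a) := by
  have hM : PolyBounded fun a =>
      (4 * sz (A a) + 1) + (sz (A a) * (4 * sz (A a) + 1 + 1) + 1) + 1 := by
    have h : PolyBounded fun a => 4 * sz (A a) + 1 :=
      ((PolyBounded.const 4).mul hA.size).add (.const 1)
    exact (h.add ((hA.size.mul (h.add (.const 1))).add (.const 1))).add (.const 1)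
  refine PolyTime.snd (PolyTime.foldr (s := fun _ _ st =>
    (false :: st.1, (true :: st.1) :: st.2.map fun r => false :: r)) hA (PolyTime.nil.pair .nil)
    (PolyTime.pair (PolyTime.cons (.bool false) PolyTime.id.snd.snd.fst)
      (PolyTime.cons (PolyTime.cons (.bool true) PolyTime.id.snd.snd.fst)
        (PolyTime.map (f := fun _ r => false :: r) PolyTime.id.snd.snd.snd
          (PolyTime.cons (.bool false) PolyTime.id.snd)))) hM fun a m hm => ?_)
  rw [unitVectors_state, sz_pair]
  have h0 := hm.length_le.trans (length_lt_sz (A a)).le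
  have h1 := sz_bits_le (List.replicate m.length false)
  have h2 : sz ((List.finRange m.length).map fun i =>
      (List.finRange m.length).map fun j => decide (j = i))
      ≤ m.length * (4 * m.length + 1 + 1) + 1 := by
    refine (sz_list_le (m := 4 * m.length + 1) fun r hr => ?_).trans (by simp)
    obtain ⟨i, -, rfl⟩ := List.mem_map.mp hr
    refine (sz_bits_le _).trans (by simp)
  rw [List.length_replicate] at h1
  have h3 : m.length * (4 * m.length + 1 + 1) ≤ sz (A a) * (4 * sz (A a) + 1 + 1) := by gcongr
  omega

theorem polyTime_members {E : α → List Bits} {S : α → Bits} (hE : PolyTime E) (hS : PolyTime S) :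
    PolyTime fun a => members (E a) (S a) :=
  PolyTime.filter (p := fun a v => meets v (S a)) hE
    (polyTime_meets PolyTime.id.snd (hS.comp PolyTime.id.fst))

theorem polyTime_remove {S v : α → Bits} (hS : PolyTime S) (hv : PolyTime v) :
    PolyTime fun a => remove (S a) (v a) :=
  polyTime_vzip (op := fun x y => x && !y) (PolyTime.id.fst.and PolyTime.id.snd.not) hS hv

theorem polyTime_componentList {A E : α → List Bits} {S : α → Bits} (hA : PolyTime A)
    (hE : PolyTime E) (hS : PolyTime S) : PolyTime fun a => componentList (A a) (E a) (S a) :=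
  polyTime_nub polyTime_eqBits (PolyTime.map (f := fun a => component (A a) (S a))
    (polyTime_members hE hS) (polyTime_component (hA.comp PolyTime.id.fst) (hS.comp PolyTime.id.fst)
      PolyTime.id.snd))

theorem polyTime_glue {δ : Type} [Enc δ] {p : α → List δ} {os : α → List (Option (List δ))}
    (hp : PolyTime p) (ho : PolyTime os) : PolyTime fun a => glue (p a) (os a) := by
  refine PolyTime.foldr (s := fun _ o acc => acc.elim none fun y => o.elim none
    fun x => some (x ++ y)) ho hp.some
    (PolyTime.optionElim (s := fun (q : α × Option (List δ) × Option (List δ)) y =>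
        q.2.1.elim none fun x => some (x ++ y))
      PolyTime.id.snd.snd .none
      (PolyTime.optionElim (s := fun q x => some (x ++ q.2)) PolyTime.id.fst.snd.fst .none
        (PolyTime.some (PolyTime.append PolyTime.id.snd PolyTime.id.fst.snd))))
    (((hp.size.add ho.size).add (.const 2))) fun a m hm => ?_
  have h1 : ∀ m : List (Option (List δ)), sz (glue (p a) m) ≤ sz (p a) + sz m + 2 := by
    intro m
    induction m with
    | nil => simp [glue]
    | cons o m ih =>
      have : glue (p a) (o :: m) = (glue (p a) m).elim none fun y =>
        o.elim none fun x => some (x ++ y) := rfl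
      rw [this, sz_cons]
      cases hg : glue (p a) m with
      | none => simp only [Option.elim_none, sz_none]; omega
      | some y =>
        rw [hg, sz_some] at ih
        cases o with
        | none => simp only [Option.elim_some, Option.elim_none, sz_none]; omega
        | some x =>
          have := sz_append_le x y
          simp only [Option.elim_some, sz_some]
          omega
  exact (h1 m).trans (by have := sz_le_of_sublist hm.sublist; omega)

theorem shortest_cons {δ : Type} (o : Option (List δ)) (cs : List (Option (List δ))) :
    shortest (o :: cs) = o.elim (shortest cs) fun x => (shortest cs).elim (some x) fun y =>
      if decide (x.length ≤ y.length) then some x else some y := rfl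

theorem shortest_mem {δ : Type} {cs : List (Option (List δ))} {x : List δ}
    (h : shortest cs = some x) : some x ∈ cs := by
  induction cs with
  | nil => cases h
  | cons o cs ih =>
    rw [shortest_cons] at h
    rw [List.mem_cons]
    cases o with
    | none => exact Or.inr (ih h)
    | some z =>
      cases hs : shortest cs with
      | none =>
        rw [hs] at h
        exact Or.inl h.symm
      | some y =>
        rw [hs] at h ih
        simp only [Option.elim_some] at h
        split_ifs at h
        · exact Or.inl h.symm
        · exact Or.inr (ih h)

theorem polyTime_shortest {δ : Type} [Enc δ] {cs : α → List (Option (List δ))}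
    (hc : PolyTime cs) : PolyTime fun a => shortest (cs a) := by
  refine PolyTime.foldr (s := fun _ o acc => o.elim acc fun x => acc.elim (some x) fun y =>
    if decide (x.length ≤ y.length) then some x else some y) hc .none
    (PolyTime.optionElim (s := fun (q : α × Option (List δ) × Option (List δ)) x =>
        q.2.2.elim (some x) fun y =>
      if decide (x.length ≤ y.length) then some x else some y)
      PolyTime.id.snd.fst PolyTime.id.snd.snd
      (PolyTime.optionElim (s := fun
        (q : (α × Option (List δ) × Option (List δ)) × List δ) y =>
        if decide (q.2.length ≤ y.length) then some q.2 else some y)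
        PolyTime.id.fst.snd.snd PolyTime.id.snd.some
        (PolyTime.cond (PolyTime.lengthLE PolyTime.id.fst.snd PolyTime.id.snd)
          PolyTime.id.fst.snd.some PolyTime.id.snd.some))) hc.size fun a m hm => ?_
  change sz (shortest m) ≤ _
  refine le_trans ?_ (sz_le_of_sublist hm.sublist)
  cases h : shortest m with
  | none => exact sz_pos m
  | some x => exact sz_le_of_mem (shortest_mem h)

theorem polyTime_lookup {T : α → List (Bits × Option Pairs)} {C : α → Bits} (hT : PolyTime T)
    (hC : PolyTime C) : PolyTime fun a => lookup (T a) (C a) :=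
  PolyTime.optionElim (s := fun _ (e : Bits × Option Pairs) => e.2)
    (PolyTime.head? (PolyTime.filter (p := fun a (e : Bits × Option Pairs) => decide (e.1 = C a)) hT
      (PolyTime.eq PolyTime.id.snd.fst (hC.comp PolyTime.id.fst)))) .none PolyTime.id.snd.snd

theorem polyTime_labelingAt {A E : α → List Bits} {T : α → List (Bits × Option Pairs)}
    {S r : α → Bits} (hA : PolyTime A) (hE : PolyTime E) (hT : PolyTime T) (hS : PolyTime S)
    (hr : PolyTime r) : PolyTime fun a => labelingAt (A a) (E a) (T a) (S a) (r a) :=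
  polyTime_glue
    (PolyTime.map (f := fun a u => (u, r a)) (polyTime_members hE hS)
      (PolyTime.id.snd.pair (hr.comp PolyTime.id.fst)))
    (PolyTime.map (f := fun a => lookup (T a)) (polyTime_componentList hA hE (polyTime_remove hS hr))
      (polyTime_lookup (hT.comp PolyTime.id.fst) PolyTime.id.snd))

theorem polyTime_nextTable {A E : α → List Bits} {T : α → List (Bits × Option Pairs)}
    (hA : PolyTime A) (hE : PolyTime E) (hT : PolyTime T) :
    PolyTime fun a => nextTable (A a) (E a) (T a) :=
  PolyTime.map (f := fun a (e : Bits × Option Pairs) => (e.1, shortest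
      ((members (E a) e.1).map (labelingAt (A a) (E a) (T a) e.1)))) hT
    (PolyTime.id.snd.fst.pair (polyTime_shortest (PolyTime.map
      (f := fun p : α × (Bits × Option Pairs) =>
        labelingAt (A p.1) (E p.1) (T p.1) p.2.1)
      (polyTime_members (hE.comp PolyTime.id.fst) PolyTime.id.snd.fst)
      (polyTime_labelingAt (hA.comp PolyTime.id.fst.fst) (hE.comp PolyTime.id.fst.fst)
        (hT.comp PolyTime.id.fst.fst) PolyTime.id.fst.snd.fst PolyTime.id.snd))))

theorem polyTime_removals {E L : α → List Bits} (hE : PolyTime E) (hL : PolyTime L) :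
    PolyTime fun a => removals (E a) (L a) :=
  hL.append (PolyTime.flatMap (f := fun a S => (E a).map (remove S)) hL
    (PolyTime.map (f := fun p : α × Bits => remove p.2) (hE.comp PolyTime.id.fst)
      (polyTime_remove PolyTime.id.fst.snd PolyTime.id.snd)))

theorem polyTime_subtreeList {A E L : α → List Bits} (hA : PolyTime A) (hE : PolyTime E)
    (hL : PolyTime L) : PolyTime fun a => subtreeList (A a) (E a) (L a) :=
  polyTime_nub polyTime_eqBits (PolyTime.flatMap
    (f := fun a => componentList (A a) (E a)) hL
    (polyTime_componentList (hA.comp PolyTime.id.fst) (hE.comp PolyTime.id.fst) PolyTime.id.snd))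

theorem polyTime_costTable {T : α → List (Bits × Option Pairs)} (hT : PolyTime T) :
    PolyTime fun a => costTable (T a) :=
  PolyTime.map (f := fun _ (e : Bits × Option Pairs) => (e.1, e.2.elim none fun P => some
      (P.map fun _ => ()))) hT
    (PolyTime.id.snd.fst.pair (PolyTime.optionElim
      (s := fun _ P => some (List.map (fun _ => ()) P)) PolyTime.id.snd.snd .none
      (PolyTime.some (PolyTime.map (f := fun _ _ => ()) PolyTime.id.snd .unit))))

theorem polyTime_finalLabels {A E : α → List Bits} {T : α → List (Bits × Option Pairs)}
    (hA : PolyTime A) (hE : PolyTime E) (hT : PolyTime T) :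
    PolyTime fun a => finalLabels (A a) (E a) (T a) := by
  have hl : PolyTime fun a => lookup (T a) ((A a).map fun _ => true) :=
    polyTime_lookup hT (PolyTime.map (f := fun _ _ => true) hA (.bool true))
  refine PolyTime.map (f := fun a u => (E a).map fun w =>
    (lookup (T a) ((A a).map fun _ => true)).elim false fun P =>
      P.any fun p => decide (p.1 = u) && decide (p.2 = w)) hE
    (PolyTime.map (f := fun (q : α × Bits) w =>
      (lookup (T q.1) ((A q.1).map fun _ => true)).elim false fun P =>
        P.any fun p => decide (p.1 = q.2) && decide (p.2 = w)) (hE.comp PolyTime.id.fst)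
      (PolyTime.optionElim (s := fun (q : (α × Bits) × Bits) P =>
        P.any fun p => decide (p.1 = q.1.2) && decide (p.2 = q.2))
        (hl.comp PolyTime.id.fst.fst) (.bool false)
        (PolyTime.any (p := fun (q : ((α × Bits) × Bits) × Pairs) p =>
          decide (p.1 = q.1.1.2) && decide (p.2 = q.1.2)) PolyTime.id.snd
          ((PolyTime.eq PolyTime.id.snd.fst PolyTime.id.fst.fst.fst.snd).and
            (PolyTime.eq PolyTime.id.snd.snd PolyTime.id.fst.fst.snd)))))

end Algorithm

/-! ### Correctness of the algorithm -/

section Correctness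

open Enc

variable {n : ℕ}

/-- The characteristic vector of a vertex set. -/
def bits (S : Finset (Fin n)) : Bits :=
  (List.finRange n).map fun i => decide (i ∈ S)

theorem bits_injective : Function.Injective (bits : Finset (Fin n) → Bits) := by
  intro S T h
  ext i
  have := List.map_inj_left.mp h i (List.mem_finRange i)
  simpa using this

theorem inter_bits (S T : Finset (Fin n)) : inter (bits S) (bits T) = bits (S ∩ T) := by
  rw [inter, bits, bits, vzip_map, bits]
  simp

theorem union_bits (S T : Finset (Fin n)) :
    vzip (fun x y => x || y) (bits S) (bits T) = bits (S ∪ T) := by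
  rw [bits, bits, vzip_map, bits]
  simp

theorem remove_bits (S : Finset (Fin n)) (v : Fin n) :
    remove (bits S) (bits {v}) = bits (S.erase v) := by
  rw [remove, bits, bits, vzip_map, bits]
  refine List.map_congr_left fun i _ => ?_
  by_cases h : i = v <;> simp [h]

theorem meets_bits (S T : Finset (Fin n)) :
    meets (bits S) (bits T) = decide (∃ v ∈ S, v ∈ T) := by
  rw [meets, inter_bits, bits, Bool.eq_iff_iff]
  simp

/-- The adjacency matrix. -/
noncomputable def adj (G : SimpleGraph (Fin n)) : List Bits :=
  open Classical in (List.finRange n).map fun i => bits {j : Fin n | G.Adj i j}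

/-- The list of all vertices. -/
def verts (n : ℕ) : List Bits :=
  (List.finRange n).map fun v => bits {v}

theorem length_adj (G : SimpleGraph (Fin n)) : (adj G).length = n := by
  simp [adj]

theorem unitVectors_eq_verts {A : List Bits} (hA : A.length = n) : unitVectors A = verts n := by
  subst hA
  rw [unitVectors_eq, verts]
  simp [bits]

theorem univ_bits {A : List Bits} (hA : A.length = n) :
    (A.map fun _ => true) = bits (Finset.univ : Finset (Fin n)) := by
  subst hA
  apply List.ext_getElem <;> simp [bits]

theorem encList_map {α β : Type} (f : α → β) (e : β → Data) (l : List α) :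
    encList e (l.map f) = encList (fun a => e (f a)) l := by
  induction l with
  | nil => rfl
  | cons a l ih => rw [List.map_cons, encList, encList, ih]

theorem enc_map {α β : Type} [Enc β] (f : α → β) (l : List α) :
    enc (l.map f) = encList (fun a => enc (f a)) l :=
  encList_map f enc l

theorem encSet_eq (S : Finset (Fin n)) : encSet S = enc (bits S) := by
  rw [encSet, List.ofFn_eq_map]
  rfl

theorem encFamily_eq (H : Fin n → Finset (Fin n)) :
    encFamily H = enc ((List.finRange n).map fun u => bits (H u)) := by
  rw [encFamily, List.ofFn_eq_map, encList_map, enc_map]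
  simp only [encSet_eq]

theorem encGraph_eq (G : SimpleGraph (Fin n)) : encGraph G = enc (adj G) := by
  rw [encGraph, encFamily_eq, adj]

/-! #### Components -/

variable {G : SimpleGraph (Fin n)}

theorem neighbours_bits (G : SimpleGraph (Fin n)) (X : Finset (Fin n)) :
    open Classical in
    neighbours (adj G) (bits X) = bits {v | ∃ u ∈ X, G.Adj u v} := by
  classical
  rw [neighbours, adj, List.map_map]
  conv_rhs => rw [bits]
  refine List.map_congr_left fun i _ => ?_
  rw [Function.comp_apply, meets_bits]
  simp only [Finset.mem_filter, Finset.mem_univ, true_and, decide_eq_decide]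
  exact ⟨fun ⟨v, h1, h2⟩ => ⟨v, h2, h1.symm⟩, fun ⟨v, h1, h2⟩ => ⟨v, h2.symm, h1⟩⟩

theorem expand_iterate (hG : G.IsTree) (S : Finset (Fin n)) (v : Fin n) (j : ℕ) :
    (expand (adj G) (bits S))^[j] (inter (bits {v}) (bits S))
      = bits ((compOf G S v).filter fun w => G.dist v w ≤ j) := by
  classical
  induction j with
  | zero =>
    rw [Function.iterate_zero, id, inter_bits]
    congr 1
    ext w
    simp only [Finset.mem_inter, Finset.mem_singleton, Finset.mem_filter, Nat.le_zero,
      hG.connected.dist_eq_zero_iff]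
    constructor
    · rintro ⟨rfl, hw⟩
      exact ⟨self_mem_compOf hG.connected hw, rfl⟩
    · rintro ⟨hw, rfl⟩
      exact ⟨rfl, mem_of_mem_compOf hw⟩
  | succ j ih =>
    rw [Function.iterate_succ_apply', ih, expand, neighbours_bits, union_bits, inter_bits]
    congr 1
    ext w
    simp only [Finset.mem_inter, Finset.mem_union, Finset.mem_filter, Finset.mem_univ, true_and]
    constructor
    · rintro ⟨h | ⟨x, ⟨hx, hd⟩, hxw⟩, hw⟩
      · exact ⟨h.1, h.2.trans (Nat.le_succ j)⟩
      · refine ⟨mem_compOf_trans hG hx (mem_compOf.mpr fun z hz => ?_), ?_⟩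
        · have h1 := SimpleGraph.dist_eq_one_iff_adj.mpr hxw
          by_cases hzx : x = z
          · exact hzx ▸ compOf_subset S v hx
          · have h2 := hG.connected.pos_dist_of_ne hzx
            unfold Btw at hz
            have : z = w := hG.connected.dist_eq_zero_iff.mp (by omega)
            exact this ▸ hw
        · have h1 := SimpleGraph.dist_eq_one_iff_adj.mpr hxw
          have h2 := hG.connected.dist_triangle (u := v) (v := x) (w := w)
          omega
    · rintro ⟨hw, hd⟩
      refine ⟨?_, compOf_subset S v hw⟩
      by_cases hvw : w = v
      · subst hvw
        exact Or.inl ⟨hw, by simp⟩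
      · obtain ⟨x, hxw, hb⟩ := exists_adj_btw hG.connected hvw
        refine Or.inr ⟨x, ⟨gconvex_compOf hG S v v
          (self_mem_compOf hG.connected (mem_of_mem_compOf hw)) w hw x hb.symm, ?_⟩, hxw.symm⟩
        have h1 := SimpleGraph.dist_eq_one_iff_adj.mpr hxw.symm
        have h2 := hb.symm
        unfold Btw at h2
        omega

theorem component_bits (hG : G.IsTree) (S : Finset (Fin n)) (v : Fin n) :
    component (adj G) (bits S) (bits {v}) = bits (compOf G S v) := by
  rw [component, expand_iterate hG, length_adj]
  congr 1
  refine Finset.filter_true_of_mem fun w _ => ?_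
  obtain ⟨p, hp, hd⟩ := hG.connected.exists_path_of_dist v w
  have := hp.length_lt
  rw [Fintype.card_fin] at this
  omega

/-- The members of a vertex set, in increasing order. -/
def elems (S : Finset (Fin n)) : List (Fin n) :=
  (List.finRange n).filter fun v => decide (v ∈ S)

@[simp] theorem mem_elems {S : Finset (Fin n)} {v : Fin n} : v ∈ elems S ↔ v ∈ S := by
  simp [elems]

theorem length_elems (S : Finset (Fin n)) : (elems S).length = S.card := by
  have h : (elems S).toFinset = S := by ext; simp
  have hn : (elems S).Nodup := (List.nodup_finRange n).filter _
  rw [← List.toFinset_card_of_nodup hn, h]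

theorem members_bits (S : Finset (Fin n)) :
    members (verts n) (bits S) = (elems S).map fun v => bits {v} := by
  rw [members, verts, elems, List.filter_map]
  congr 1
  refine List.filter_congr fun v _ => ?_
  rw [Function.comp_apply, meets_bits]
  simp

/-- The components of the graph induced by `S`, as a list. -/
noncomputable def compList (G : SimpleGraph (Fin n)) (S : Finset (Fin n)) :
    List (Finset (Fin n)) :=
  nub ((elems S).map (compOf G S))

theorem componentList_bits (hG : G.IsTree) (S : Finset (Fin n)) :
    componentList (adj G) (verts n) (bits S) = (compList G S).map bits := by
  rw [componentList, compList, members_bits, ← nub_map bits_injective, List.map_map, List.map_map]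
  congr 1
  exact List.map_congr_left fun v _ => component_bits hG S v

theorem mem_compList (hG : G.IsTree) {S C : Finset (Fin n)} :
    C ∈ compList G S ↔ C ∈ components G S := by
  rw [compList, mem_nub, mem_components_iff hG, List.mem_map]
  simp only [mem_elems, eq_comm]

theorem sum_compList {M : Type} [AddCommMonoid M] (hG : G.IsTree) (S : Finset (Fin n))
    (f : Finset (Fin n) → M) :
    ((compList G S).map f).sum = ∑ C ∈ components G S, f C := by
  have hn : (compList G S).Nodup := nodup_nub _
  rw [← List.sum_toFinset f hn]
  congr 1
  ext C
  rw [List.mem_toFinset]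
  exact mem_compList hG

/-! #### Candidates for subtrees -/

/-- All sets that arise from one of the sets in `L` by removing at most one vertex. -/
def eraseAll (L : List (Finset (Fin n))) : List (Finset (Fin n)) :=
  L ++ L.flatMap fun S => (List.finRange n).map S.erase

/-- The sets that contain all but at most `k` vertices, with repetitions. -/
def largeSets (n k : ℕ) : List (Finset (Fin n)) :=
  eraseAll^[k] [Finset.univ]

theorem removals_bits (L : List (Finset (Fin n))) :
    removals (verts n) (L.map bits) = (eraseAll L).map bits := by
  rw [removals, eraseAll, List.map_append, List.flatMap_map, List.map_flatMap]
  congr 2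
  funext S
  rw [verts, List.map_map, List.map_map]
  exact List.map_congr_left fun v _ => remove_bits S v

theorem removals_iterate {A : List Bits} (hA : A.length = n) (k : ℕ) :
    (removals (verts n))^[k] [A.map fun _ => true] = (largeSets n k).map bits := by
  induction k with
  | zero => rw [univ_bits hA]; rfl
  | succ k ih =>
    rw [Function.iterate_succ_apply', ih, removals_bits, largeSets, largeSets,
      Function.iterate_succ_apply']

theorem length_largeSets (k : ℕ) : (largeSets n k).length = (n + 1) ^ k := by
  induction k with
  | zero => rfl
  | succ k ih =>
    rw [largeSets, Function.iterate_succ_apply', ← largeSets, eraseAll, List.length_append,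
      List.length_flatMap]
    simp only [List.length_map, List.length_finRange, List.map_const', List.sum_replicate, ih,
      smul_eq_mul]
    ring

theorem mem_largeSets {k : ℕ} {S : Finset (Fin n)} : S ∈ largeSets n k ↔ Sᶜ.card ≤ k := by
  induction k generalizing S with
  | zero => simp [largeSets, Finset.compl_eq_empty_iff]
  | succ k ih =>
    rw [largeSets, Function.iterate_succ_apply', ← largeSets, eraseAll, List.mem_append,
      List.mem_flatMap, ih]
    simp only [List.mem_map, List.mem_finRange, true_and, ih]
    constructor
    · rintro (h | ⟨T, hT, v, rfl⟩)
      · omega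
      · have := Finset.card_insert_le v Tᶜ
        rw [Finset.compl_erase]
        omega
    · intro h
      by_cases hS : Sᶜ.card ≤ k
      · exact Or.inl hS
      · obtain ⟨v, hv⟩ : Sᶜ.Nonempty := Finset.card_pos.mp (by omega)
        refine Or.inr ⟨insert v S, ?_, v, Finset.erase_insert (Finset.mem_compl.mp hv)⟩
        rw [Finset.compl_insert, Finset.card_erase_of_mem hv]
        omega

/-- The subtrees with a boundary of size at most `k`. -/
noncomputable def subtrees (G : SimpleGraph (Fin n)) (k : ℕ) : List (Finset (Fin n)) :=
  nub ((largeSets n k).flatMap (compList G))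

theorem subtreeList_bits (hG : G.IsTree) (k : ℕ) :
    subtreeList (adj G) (verts n) ((largeSets n k).map bits) = (subtrees G k).map bits := by
  rw [subtreeList, subtrees, ← nub_map bits_injective, List.flatMap_map, List.map_flatMap]
  congr 2
  funext S
  exact componentList_bits hG S

theorem mem_subtrees (hG : G.IsTree) {k : ℕ} {S : Finset (Fin n)} :
    S ∈ subtrees G k ↔ IsSubtree G S ∧ (boundary G S).card ≤ k := by
  rw [subtrees, mem_nub, List.mem_flatMap]
  simp only [mem_largeSets, mem_compList hG]
  constructor
  · rintro ⟨A, hA, hS⟩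
    refine ⟨isSubtree_of_mem_components hG hS, ?_⟩
    obtain ⟨v, hv, rfl⟩ := (mem_components_iff hG).mp hS
    exact (Finset.card_le_card (boundary_compOf_subset hG A v)).trans hA
  · rintro ⟨hS, hk⟩
    obtain ⟨v, hv⟩ := ((isSubtree_iff hG).mp hS).1
    have h := compOf_compl_boundary hG hS hv
    refine ⟨(boundary G S)ᶜ, by rwa [compl_compl], (mem_components_iff hG).mpr ⟨v, ?_, h.symm⟩⟩
    refine mem_of_mem_compOf (G := G) (w := v) ?_
    rw [h]
    exact hv

/-! #### Entries of the table -/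

/-- The entry of the table for `S` after `j` rounds, if `K` is the list of keys. -/
noncomputable def entry (G : SimpleGraph (Fin n)) (K : List (Finset (Fin n))) :
    ℕ → Finset (Fin n) → Option (List (Fin n × Fin n))
  | 0, _ => none
  | j + 1, S => shortest ((elems S).map fun r => glue ((elems S).map fun u => (u, r))
      ((compList G (S.erase r)).map fun C => if C ∈ K then entry G K j C else none))

/-- The representation of a list of pairs of vertices. -/
def pairBits (P : List (Fin n × Fin n)) : Pairs :=
  P.map fun p => (bits {p.1}, bits {p.2})

theorem glue_cons {δ : Type} (p : List δ) (o : Option (List δ)) (os : List (Option (List δ))) :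
    glue p (o :: os) = (glue p os).elim none fun y => o.elim none fun x => some (x ++ y) := rfl

theorem glue_map {δ ε : Type} (f : δ → ε) (p : List δ) (os : List (Option (List δ))) :
    glue (p.map f) (os.map (Option.map (List.map f))) = (glue p os).map (List.map f) := by
  induction os with
  | nil => rfl
  | cons o os ih =>
    rw [List.map_cons, glue_cons, glue_cons, ih]
    cases glue p os <;> cases o <;> simp

theorem shortest_map {δ ε : Type} (f : δ → ε) (cs : List (Option (List δ))) :
    shortest (cs.map (Option.map (List.map f))) = (shortest cs).map (List.map f) := by
  induction cs with
  | nil => rfl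
  | cons o cs ih =>
    rw [List.map_cons, shortest_cons, shortest_cons, ih]
    cases o with
    | none => rfl
    | some x =>
      cases shortest cs with
      | none => rfl
      | some y =>
        simp only [Option.map_some, Option.elim_some, List.length_map]
        split_ifs <;> rfl

theorem lookup_bits (K : List (Finset (Fin n))) (f : Finset (Fin n) → Option Pairs)
    (C : Finset (Fin n)) :
    lookup (K.map fun S => (bits S, f S)) (bits C) = if C ∈ K then f C else none := by
  induction K with
  | nil => rfl
  | cons S K ih =>
    rw [lookup] at ih ⊢
    rw [List.map_cons, List.filter_cons]
    by_cases h : S = C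
    · subst h
      simp
    · have h1 : bits S ≠ bits C := fun h' => h (bits_injective h')
      have h2 : C ≠ S := fun h' => h h'.symm
      simp only [h1, decide_false, Bool.false_eq_true, if_false, List.mem_cons, h2, false_or]
      exact ih

theorem nextTable_bits (hG : G.IsTree) (K : List (Finset (Fin n))) (j : ℕ) :
    nextTable (adj G) (verts n) (K.map fun S => (bits S, (entry G K j S).map pairBits))
      = K.map fun S => (bits S, (entry G K (j + 1) S).map pairBits) := by
  rw [nextTable, List.map_map]
  refine List.map_congr_left fun S _ => ?_
  refine Prod.ext rfl ?_
  simp only [Function.comp_apply]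
  rw [entry, members_bits, List.map_map]
  have : pairBits (n := n) = List.map fun p => (bits {p.1}, bits {p.2}) := rfl
  rw [this, ← shortest_map, List.map_map]
  congr 1
  refine List.map_congr_left fun r _ => ?_
  rw [Function.comp_apply, Function.comp_apply, ← glue_map, labelingAt, remove_bits,
    componentList_bits hG, members_bits, List.map_map, List.map_map, List.map_map, List.map_map]
  congr 1
  refine List.map_congr_left fun C _ => ?_
  rw [Function.comp_apply, Function.comp_apply, lookup_bits]
  split_ifs <;> rfl

theorem nextTable_iterate (hG : G.IsTree) (K : List (Finset (Fin n))) (j : ℕ) :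
    (nextTable (adj G) (verts n))^[j] ((K.map bits).map fun S => (S, none))
      = K.map fun S => (bits S, (entry G K j S).map pairBits) := by
  induction j with
  | zero =>
    rw [Function.iterate_zero, id, List.map_map]
    rfl
  | succ j ih => rw [Function.iterate_succ_apply', ih, nextTable_bits hG]

/-- The cost of a labeling that may be missing. -/
def costOf {δ : Type} (o : Option (List δ)) : ℕ∞ :=
  o.elim ⊤ fun P => (P.length : ℕ∞)

theorem costOf_glue {δ : Type} (p : List δ) (os : List (Option (List δ))) :
    costOf (glue p os) = p.length + (os.map costOf).sum := by
  induction os with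
  | nil => simp [glue, costOf]
  | cons o os ih =>
    rw [glue_cons, List.map_cons, List.sum_cons, add_left_comm, ← ih]
    cases glue p os <;> cases o <;> simp [costOf]

theorem costOf_shortest_le {δ : Type} {cs : List (Option (List δ))} {o : Option (List δ)}
    (h : o ∈ cs) : costOf (shortest cs) ≤ costOf o := by
  induction cs with
  | nil => simp at h
  | cons o' cs ih =>
    rw [shortest_cons]
    rcases List.mem_cons.mp h with rfl | h
    · cases o with
      | none => exact le_top
      | some x =>
        cases shortest cs with
        | none => exact le_rfl
        | some y =>
          simp only [Option.elim_some]
          split_ifs with hxy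
          · exact le_rfl
          · simp only [decide_eq_true_eq, not_le] at hxy
            simp only [costOf, Option.elim_some, Nat.cast_le]
            omega
    · have h1 := ih h
      cases o' with
      | none => exact h1
      | some x =>
        cases hs : shortest cs with
        | none =>
          rw [hs] at h1
          exact le_top.trans h1
        | some y =>
          rw [hs] at h1
          simp only [Option.elim_some]
          split_ifs with hxy
          · refine le_trans ?_ h1
            simpa [costOf] using hxy
          · exact h1

/-- After as many rounds as `S` has vertices, the entry for `S` is final. -/
theorem costOf_entry (hG : G.IsTree) {k : ℕ} {j : ℕ} {S : Finset (Fin n)} (hj : S.card ≤ j)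
    (hS : S ∈ subtrees G k) : costOf (entry G (subtrees G k) j S) = dp G k S := by
  induction j generalizing S with
  | zero =>
    have := ((isSubtree_iff hG).mp ((mem_subtrees hG).mp hS).1).1.card_pos
    omega
  | succ j ih =>
    obtain ⟨hsub, hb⟩ := (mem_subtrees hG).mp hS
    have hne := ((isSubtree_iff hG).mp hsub).1
    rw [dp_eq hb, entry]
    set f : Fin n → Option (List (Fin n × Fin n)) := fun r =>
      glue ((elems S).map fun u => (u, r)) ((compList G (S.erase r)).map fun C =>
        if C ∈ subtrees G k then entry G (subtrees G k) j C else none) with hf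
    have hcost : ∀ r ∈ S, costOf (f r)
        = S.card + ∑ C ∈ components G (S.erase r), dp G k C := by
      intro r hr
      rw [hf, costOf_glue, List.length_map, length_elems, List.map_map, sum_compList hG]
      congr 1
      refine Finset.sum_congr rfl fun C hC => ?_
      have hlt := card_lt_of_mem_components hr hC
      rw [Function.comp_apply]
      split_ifs with hCK
      · exact ih (by omega) hCK
      · rw [dp_eq_top]
        · rfl
        · exact fun h => hCK ((mem_subtrees hG).mpr ⟨isSubtree_of_mem_components hG hC, h⟩)
    refine le_antisymm ?_ ?_
    · have : Nonempty {r // r ∈ S} := ⟨⟨_, hne.choose_spec⟩⟩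
      obtain ⟨r, hr⟩ := ciInf_mem fun r : {r // r ∈ S} =>
        ∑ C ∈ components G (S.erase r.1), dp G k C
      rw [← hr]
      exact (costOf_shortest_le (List.mem_map_of_mem (mem_elems.mpr r.2))).trans
        (hcost r.1 r.2).le
    · cases hs : shortest ((elems S).map f) with
      | none => exact le_top
      | some P =>
        obtain ⟨r, hr, hrP⟩ := List.mem_map.mp (shortest_mem hs)
        rw [mem_elems] at hr
        rw [← hrP, hcost r hr]
        gcongr
        exact iInf_le (fun r : {r // r ∈ S} => ∑ C ∈ components G (S.erase r.1), dp G k C) ⟨r, hr⟩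

theorem glue_eq_some {δ : Type} {p : List δ} {os : List (Option (List δ))} {P : List δ}
    (h : glue p os = some P) : (∀ x ∈ p, x ∈ P) ∧ (∀ o ∈ os, ∃ y, o = some y ∧ ∀ x ∈ y, x ∈ P) ∧
      P.length = p.length + (os.map fun o => (o.getD []).length).sum := by
  induction os generalizing P with
  | nil =>
    obtain rfl : p = P := Option.some.inj h
    simp
  | cons o os ih =>
    rw [glue_cons] at h
    cases hg : glue p os with
    | none => rw [hg] at h; cases h
    | some y =>
      cases o with
      | none => rw [hg] at h; cases h
      | some x =>
        rw [hg] at h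
        obtain rfl : x ++ y = P := Option.some.inj h
        obtain ⟨h1, h2, h3⟩ := ih hg
        refine ⟨fun z hz => List.mem_append_right _ (h1 z hz), fun o ho => ?_, ?_⟩
        · rcases List.mem_cons.mp ho with rfl | ho
          · exact ⟨x, rfl, fun z hz => List.mem_append_left _ hz⟩
          · obtain ⟨z, hz, hzy⟩ := h2 o ho
            exact ⟨z, hz, fun w hw => List.mem_append_right _ (hzy w hw)⟩
        · simp only [List.length_append, List.map_cons, List.sum_cons, Option.getD_some]
          omega

theorem entry_succ_eq_some {K : List (Finset (Fin n))} {j : ℕ} {S : Finset (Fin n)}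
    {P : List (Fin n × Fin n)} (h : entry G K (j + 1) S = some P) :
    ∃ r ∈ S, (∀ u ∈ S, (u, r) ∈ P) ∧
      (∀ C ∈ compList G (S.erase r), ∃ Q, entry G K j C = some Q ∧ ∀ x ∈ Q, x ∈ P) ∧
      P.length = S.card +
        ((compList G (S.erase r)).map fun C => ((entry G K j C).getD []).length).sum := by
  rw [entry] at h
  obtain ⟨r, hr, hg⟩ := List.mem_map.mp (shortest_mem h)
  obtain ⟨h1, h2, h3⟩ := glue_eq_some hg
  have h4 : ∀ C ∈ compList G (S.erase r), ∃ Q, (if C ∈ K then entry G K j C else none) = some Q ∧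
      ∀ x ∈ Q, x ∈ P := fun C hC => h2 _ (List.mem_map_of_mem hC)
  have h5 : ∀ C ∈ compList G (S.erase r), C ∈ K := by
    intro C hC
    by_contra hCK
    obtain ⟨Q, hQ, -⟩ := h4 C hC
    rw [if_neg hCK] at hQ
    cases hQ
  refine ⟨r, mem_elems.mp hr, fun u hu => h1 _ (List.mem_map_of_mem (mem_elems.mpr hu)),
    fun C hC => ?_, ?_⟩
  · have := h4 C hC
    rwa [if_pos (h5 C hC)] at this
  · rw [h3, List.length_map, length_elems, List.map_map]
    congr 2
    refine List.map_congr_left fun C hC => ?_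
    rw [Function.comp_apply, if_pos (h5 C hC)]

/-- The entries of the table are labelings. -/
theorem labels_entry (hG : G.IsTree) {K : List (Finset (Fin n))} {j : ℕ} {S : Finset (Fin n)}
    (hS : IsSubtree G S) {P : List (Fin n × Fin n)} (h : entry G K j S = some P) :
    Labels G S P.toFinset := by
  induction j generalizing S P with
  | zero => cases h
  | succ j ih =>
    obtain ⟨r, -, h1, h2, -⟩ := entry_succ_eq_some h
    refine Labels.glue hG hS (r := r) (R := fun C => ((entry G K j C).getD []).toFinset)
      (fun C hC => ?_) (fun C hC => ?_) fun u hu => List.mem_toFinset.mpr (h1 u hu)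
    · obtain ⟨Q, hQ, -⟩ := h2 C ((mem_compList hG).mpr hC)
      simp only [hQ, Option.getD_some]
      exact ih (isSubtree_of_mem_components hG hC) hQ
    · obtain ⟨Q, hQ, hQP⟩ := h2 C ((mem_compList hG).mpr hC)
      simp only [hQ, Option.getD_some]
      intro x hx
      exact List.mem_toFinset.mpr (hQP x (List.mem_toFinset.mp hx))

theorem length_entry_le (hG : G.IsTree) {K : List (Finset (Fin n))} {j : ℕ} {S : Finset (Fin n)}
    {P : List (Fin n × Fin n)} (h : entry G K j S = some P) : P.length ≤ j * S.card := by
  induction j generalizing S P with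
  | zero => cases h
  | succ j ih =>
    obtain ⟨r, hr, -, h2, h3⟩ := entry_succ_eq_some h
    rw [h3, sum_compList hG]
    have h4 : ∀ C ∈ components G (S.erase r), ((entry G K j C).getD []).length ≤ j * C.card := by
      intro C hC
      obtain ⟨Q, hQ, -⟩ := h2 C ((mem_compList hG).mpr hC)
      rw [hQ]
      exact ih hQ
    have h5 := Finset.sum_le_sum h4
    rw [← Finset.mul_sum] at h5
    have h6 := Nat.mul_le_mul_left j ((sum_card_components_le hG (S.erase r)).trans
      (Finset.card_le_card (Finset.erase_subset r S)))
    rw [Nat.add_mul]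
    omega

/-- The labeling with the given pairs. -/
def labelsOf (P : List (Fin n × Fin n)) (u : Fin n) : Finset (Fin n) :=
  {w | (u, w) ∈ P}

theorem finalLabels_bits {K : List (Finset (Fin n))} {j : ℕ} (hK : Finset.univ ∈ K)
    {P : List (Fin n × Fin n)} (hP : entry G K j Finset.univ = some P) :
    finalLabels (adj G) (verts n) (K.map fun S => (bits S, (entry G K j S).map pairBits))
      = (List.finRange n).map fun u => bits (labelsOf P u) := by
  rw [finalLabels, univ_bits (length_adj G), lookup_bits, if_pos hK, hP, verts, List.map_map]
  refine List.map_congr_left fun u _ => ?_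
  rw [Function.comp_apply, List.map_map]
  conv_rhs => rw [bits]
  refine List.map_congr_left fun w _ => ?_
  rw [Function.comp_apply, Option.map_some, Option.elim_some, Bool.eq_iff_iff]
  simp only [pairBits, List.any_map, List.any_eq_true, Function.comp_apply, Bool.and_eq_true,
    decide_eq_true_eq, bits_injective.eq_iff, Finset.singleton_inj, labelsOf, Finset.mem_filter,
    Finset.mem_univ, true_and]
  constructor
  · rintro ⟨⟨a, b⟩, h, rfl, rfl⟩
    exact h
  · exact fun h => ⟨(u, w), h, rfl, rfl⟩

theorem isHubLabeling_iff (hG : G.IsTree) (H : Fin n → Finset (Fin n)) :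
    IsHubLabeling G H ↔
      Labels G Finset.univ (Finset.univ.filter fun p : Fin n × Fin n => p.2 ∈ H p.1) := by
  simp only [IsHubLabeling, Labels, Finset.mem_univ, forall_true_left, Finset.mem_filter, true_and,
    btw_iff_exists_walk hG.connected]

theorem card_pairs_eq_cost (H : Fin n → Finset (Fin n)) :
    (Finset.univ.filter fun p : Fin n × Fin n => p.2 ∈ H p.1).card = cost H := by
  rw [cost, ← Finset.card_sigma]
  refine Finset.card_bij' (fun p _ => ⟨p.1, p.2⟩) (fun p _ => (p.1, p.2)) ?_ ?_ ?_ ?_ <;> simp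

theorem opt_le_cost (hG : G.IsTree) {H : Fin n → Finset (Fin n)} (h : IsHubLabeling G H) :
    opt G Finset.univ ≤ cost H := by
  rw [← card_pairs_eq_cost]
  exact ((isHubLabeling_iff hG H).mp h).opt_le hG (isSubtree_univ hG)

/-- A final entry of the whole tree whose cost is the unbounded optimum is an optimal labeling. -/
theorem isOptimal_labelsOf (hG : G.IsTree) {P : List (Fin n × Fin n)}
    (hP : Labels G Finset.univ P.toFinset) (hopt : (P.length : ℕ∞) = opt G Finset.univ) :
    IsOptimal G (labelsOf P) ∧ opt G Finset.univ = cost (labelsOf P) := by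
  have hset : (Finset.univ.filter fun p : Fin n × Fin n => p.2 ∈ labelsOf P p.1) = P.toFinset := by
    ext p
    simp [labelsOf]
  have h1 : IsHubLabeling G (labelsOf P) := by rwa [isHubLabeling_iff hG, hset]
  have h2 : (cost (labelsOf P) : ℕ∞) ≤ opt G Finset.univ := by
    rw [← card_pairs_eq_cost, hset, ← hopt]
    exact_mod_cast P.toFinset_card_le
  refine ⟨⟨h1, fun H' h' => ?_⟩, le_antisymm (opt_le_cost hG h1) h2⟩
  exact_mod_cast h2.trans (opt_le_cost hG h')

end Correctness

/-! ### The running time of the algorithm -/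

section RunningTime

open Enc

/-- The inputs of the algorithm. -/
structure TreeInput where
  n : ℕ
  G : SimpleGraph (Fin n)
  isTree : G.IsTree

noncomputable instance : Enc TreeInput := ⟨fun x => encGraph x.G⟩

/-- The bound on the size of a boundary. -/
def TreeInput.bound (x : TreeInput) : ℕ :=
  19 * Nat.log 2 x.n

/-- An input after the first phase of the algorithm, represented by the adjacency matrix together
with the list of the large sets. -/
structure Prepared where
  input : TreeInput

/-- The list of large sets computed in the first phase. -/
def Prepared.sets (y : Prepared) : List Bits :=
  (largeSets y.input.n y.input.bound).map bits

noncomputable instance : Enc Prepared := ⟨fun y => enc (adj y.input.G, y.sets)⟩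

theorem TreeInput.n_pos (x : TreeInput) : 1 ≤ x.n := by
  obtain ⟨v⟩ := x.isTree.connected.nonempty
  exact Nat.one_le_of_lt v.2

/-- A bound of the form `n ^ O(log n)`. -/
def QuasiPoly (T : TreeInput → ℕ) : Prop :=
  ∃ C, ∀ x, T x ≤ C * x.n ^ (C * Nat.log 2 x.n)

theorem QuasiPoly.mono {T U : TreeInput → ℕ} (hU : QuasiPoly U) (h : ∀ x, T x ≤ U x) :
    QuasiPoly T := by
  obtain ⟨C, hC⟩ := hU
  exact ⟨C, fun x => (h x).trans (hC x)⟩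

theorem QuasiPoly.of_le {T : TreeInput → ℕ} (C D : ℕ)
    (h : ∀ x, T x ≤ C * x.n ^ (D * Nat.log 2 x.n)) : QuasiPoly T := by
  refine ⟨C + D, fun x => (h x).trans (Nat.mul_le_mul (by omega) ?_)⟩
  exact Nat.pow_le_pow_right x.n_pos (Nat.mul_le_mul_right _ (by omega))

theorem QuasiPoly.const (k : ℕ) : QuasiPoly fun _ => k :=
  .of_le k 0 fun x => by simp

theorem QuasiPoly.mul {T U : TreeInput → ℕ} (hT : QuasiPoly T) (hU : QuasiPoly U) :
    QuasiPoly fun x => T x * U x := by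
  obtain ⟨C, hC⟩ := hT
  obtain ⟨D, hD⟩ := hU
  refine .of_le (C * D) (C + D) fun x => (Nat.mul_le_mul (hC x) (hD x)).trans (le_of_eq ?_)
  rw [Nat.add_mul, pow_add]
  ring

theorem QuasiPoly.add {T U : TreeInput → ℕ} (hT : QuasiPoly T) (hU : QuasiPoly U) :
    QuasiPoly fun x => T x + U x := by
  obtain ⟨C, hC⟩ := hT
  obtain ⟨D, hD⟩ := hU
  refine .of_le (C + D) (C + D) fun x => ?_
  rw [Nat.add_mul]
  refine Nat.add_le_add ((hC x).trans ?_) ((hD x).trans ?_) <;>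
  exact Nat.mul_le_mul_left _ (Nat.pow_le_pow_right x.n_pos (Nat.mul_le_mul_right _ (by omega)))

theorem QuasiPoly.pow {T : TreeInput → ℕ} (hT : QuasiPoly T) (k : ℕ) :
    QuasiPoly fun x => T x ^ k := by
  induction k with
  | zero => exact (QuasiPoly.const 1).mono fun x => by simp
  | succ k ih => exact (ih.mul hT).mono fun x => (pow_succ _ _).le

theorem QuasiPoly.card : QuasiPoly fun x => x.n := by
  refine .of_le 1 1 fun x => ?_
  rw [one_mul, one_mul]
  rcases Nat.lt_or_ge x.n 2 with h | h
  · have := x.n_pos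
    obtain h : x.n = 1 := by omega
    simp [h]
  · exact Nat.le_self_pow (Nat.log_pos (by norm_num) h).ne' _

theorem QuasiPoly.succ_pow_bound : QuasiPoly fun x => (x.n + 1) ^ x.bound := by
  refine ((QuasiPoly.card.pow 19).mul (.of_le (T := fun x => x.n ^ (19 * Nat.log 2 x.n)) 1 19
    fun x => by simp)).mono fun x => ?_
  have h1 := x.n_pos
  calc (x.n + 1) ^ x.bound ≤ (2 * x.n) ^ (19 * Nat.log 2 x.n) :=
        Nat.pow_le_pow_left (by omega) _
    _ = (2 ^ Nat.log 2 x.n) ^ 19 * x.n ^ (19 * Nat.log 2 x.n) := by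
        rw [mul_pow, ← pow_mul, mul_comm (Nat.log 2 x.n) 19]
    _ ≤ x.n ^ 19 * x.n ^ (19 * Nat.log 2 x.n) := by
        gcongr
        exact Nat.pow_log_le_self 2 (by omega)

theorem sz_bits {n : ℕ} (S : Finset (Fin n)) : sz (bits S) ≤ 4 * n + 1 :=
  (sz_bits_le _).trans (by simp [bits])

theorem sz_adj_le {n : ℕ} (G : SimpleGraph (Fin n)) : sz (adj G) ≤ n * (4 * n + 2) + 1 := by
  refine (sz_list_le (m := 4 * n + 1) fun r hr => ?_).trans (by rw [length_adj])
  obtain ⟨i, -, rfl⟩ := List.mem_map.mp hr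
  exact sz_bits _

theorem QuasiPoly.size : QuasiPoly fun x => sz x := by
  refine ((QuasiPoly.card.mul (((QuasiPoly.const 4).mul .card).add (.const 2))).add
    (.const 1)).mono fun x => ?_
  rw [sz]
  change (encGraph x.G).size ≤ _
  rw [encGraph_eq]
  exact sz_adj_le x.G

theorem QuasiPoly.of_polyBounded {T : TreeInput → ℕ} (hT : PolyBounded T) : QuasiPoly T := by
  obtain ⟨C, hC⟩ := hT
  exact ((QuasiPoly.size.add (.const 2)).pow C).mono hC

theorem PolyTime.adj : PolyTime fun x : TreeInput => adj x.G := by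
  refine .of_term (.var 0) 1 (fun x => ?_) fun P x => ⟨1, le_rfl, .var ?_⟩
  · have : enc x = enc (HubLabeling.adj x.G) := encGraph_eq x.G
    rw [sz, sz, this]
    omega
  · exact congrArg Option.some (encGraph_eq x.G)

theorem PolyTime.replicate {α : Type} [Enc α] (k : ℕ) :
    PolyTime fun _ : α => List.replicate k () := by
  induction k with
  | zero => exact .nil
  | succ k ih => exact PolyTime.cons .unit ih

/-- A list with as many elements as the bound on the size of a boundary. -/
def boundList (A : List Bits) : List Unit :=
  (logList A).flatMap fun _ => List.replicate 19 ()

theorem length_boundList {n : ℕ} {A : List Bits} (hA : A.length = n) :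
    (boundList A).length = 19 * Nat.log 2 n := by
  rw [boundList, List.length_flatMap]
  simp [length_logList, hA, mul_comm]

theorem sz_largeSets_le {n j k : ℕ} (hj : j ≤ k) :
    sz ((largeSets n j).map bits) ≤ (n + 1) ^ k * (4 * n + 2) + 1 := by
  refine (sz_list_le (m := 4 * n + 1) fun r hr => ?_).trans ?_
  · obtain ⟨S, -, rfl⟩ := List.mem_map.mp hr
    exact sz_bits S
  · rw [List.length_map, length_largeSets]
    gcongr
    omega

/-- The only phase that takes more than polynomial time: listing the large sets. -/
theorem computes_prepared :
    ∃ T, QuasiPoly T ∧ Computes (fun x : TreeInput => Prepared.mk x) T := by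
  let l : TreeInput → List Unit := fun x => boundList (adj x.G)
  let b : TreeInput → List Bits := fun x => [(adj x.G).map fun _ => true]
  let s : TreeInput → Unit → List Bits → List Bits := fun x _ L =>
    removals (unitVectors (adj x.G)) L
  let M : TreeInput → ℕ := fun x => (x.n + 1) ^ x.bound * (4 * x.n + 2) + 1
  have hM : QuasiPoly M := (QuasiPoly.succ_pow_bound.mul
    (((QuasiPoly.const 4).mul .card).add (.const 2))).add (.const 1)
  have hfold : ∀ x (m : List Unit),
      m.foldr (s x) (b x) = (largeSets x.n m.length).map bits := by
    intro x m
    rw [← removals_iterate (length_adj x.G), ← unitVectors_eq_verts (length_adj x.G),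
      ← List.foldr_const]
  have hlen : ∀ x, (l x).length = x.bound := fun x => length_boundList (length_adj x.G)
  have hl : PolyTime l := PolyTime.flatMap (f := fun _ _ => List.replicate 19 ())
    (polyTime_logList .adj) (.replicate 19)
  have hb : PolyTime b := PolyTime.cons (PolyTime.map (f := fun _ _ => true) .adj (.bool true)) .nil
  have hs : PolyTime fun p : TreeInput × Unit × List Bits => s p.1 p.2.1 p.2.2 :=
    polyTime_removals (polyTime_unitVectors (PolyTime.comp .adj PolyTime.id.fst))
      PolyTime.id.snd.snd
  have hlsize := QuasiPoly.of_polyBounded hl.size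
  obtain ⟨T, hT, hl⟩ := hl
  obtain ⟨U, hU, hb⟩ := hb
  obtain ⟨X, ⟨C, hX⟩, hs⟩ := hs
  obtain ⟨N, hN, hadj⟩ := PolyTime.adj
  have hW : QuasiPoly fun x => (sz x + M x + 5) ^ C := ((QuasiPoly.size.add hM).add (.const 5)).pow C
  have hfoldr := hl.foldr hb hs (M := M) (W := fun x => (sz x + M x + 5) ^ C)
    (fun x => by rw [hfold]; exact sz_largeSets_le (hlen x).le)
    (fun x u m hm => by
      refine (hX _).trans (Nat.pow_le_pow_left ?_ C)
      have h1 := hm.length_le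
      rw [hlen, List.length_cons] at h1
      have h2 : sz (m.foldr (s x) (b x)) ≤ M x := by
        rw [hfold]
        exact sz_largeSets_le (by omega)
      rw [sz_pair, sz_pair, sz_unit]
      omega)
  have hpair := hadj.pair hfoldr
  refine ⟨_, ((QuasiPoly.of_polyBounded hN).add ((hM.add (QuasiPoly.of_polyBounded hT)).add
    ((hlsize.add (.const 1)).mul ((hW.add (QuasiPoly.of_polyBounded hU)).add (.const 20))))).add
    (.const 1), ?_⟩
  have henc : ∀ x : TreeInput, enc (Prepared.mk x) = enc (adj x.G, (l x).foldr (s x) (b x)) := by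
    intro x
    rw [hfold, hlen]
    rfl
  have hsz : ∀ x : TreeInput, sz (Prepared.mk x) = sz (adj x.G, (l x).foldr (s x) (b x)) :=
    fun x => congrArg Data.size (henc x)
  refine ⟨fun x => (hsz x).le.trans (hpair.1 x), fun q => ?_⟩
  obtain ⟨R, e, h⟩ := hpair.2 q
  refine ⟨R, e, fun Q S hQ x => ?_⟩
  obtain ⟨t, ht, he⟩ := h Q S hQ x
  exact ⟨t, ht, by rw [henc]; exact he⟩

theorem polyTime_prepared : PolyTime fun y : Prepared => (adj y.input.G, y.sets) :=
  .of_term (.var 0) 1 (fun _ => Nat.le_succ _) fun _ _ => ⟨1, le_rfl, .var rfl⟩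

theorem sz_entry_le {n : ℕ} {G : SimpleGraph (Fin n)} (hG : G.IsTree)
    (K : List (Finset (Fin n))) {j : ℕ} (hj : j ≤ n) (S : Finset (Fin n)) :
    sz ((entry G K j S).map pairBits) ≤ n * n * (8 * n + 4) + 3 := by
  cases h : entry G K j S with
  | none =>
    rw [Option.map_none, sz_none]
    omega
  | some P =>
    have h1 := (length_entry_le hG h).trans (Nat.mul_le_mul hj ((Finset.card_le_univ S).trans
      (Fintype.card_fin n).le))
    have h2 : sz (pairBits P) ≤ P.length * (8 * n + 3 + 1) + 1 := by
      refine (sz_list_le (m := 8 * n + 3) fun p hp => ?_).trans (by rw [pairBits, List.length_map])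
      obtain ⟨q, -, rfl⟩ := List.mem_map.mp hp
      have h3 := sz_bits {q.1}
      have h4 := sz_bits {q.2}
      rw [sz_pair]
      omega
    have h3 := Nat.mul_le_mul_right (8 * n + 3 + 1) h1
    rw [show 8 * n + 3 + 1 = 8 * n + 4 from rfl] at h2 h3
    rw [Option.map_some, sz_some]
    omega

theorem Prepared.table_eq (y : Prepared) (j : ℕ) :
    (nextTable (adj y.input.G) (unitVectors (adj y.input.G)))^[j]
      ((subtreeList (adj y.input.G) (unitVectors (adj y.input.G)) y.sets).map fun S => (S, none))
    = (subtrees y.input.G y.input.bound).map fun S =>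
      (bits S, (entry y.input.G (subtrees y.input.G y.input.bound) j S).map pairBits) := by
  rw [unitVectors_eq_verts (length_adj _), Prepared.sets, subtreeList_bits y.input.isTree,
    nextTable_iterate y.input.isTree]

/-- The table computed by the algorithm. -/
noncomputable def Prepared.table (y : Prepared) : List (Bits × Option Pairs) :=
  finalTable (adj y.input.G) (unitVectors (adj y.input.G)) y.sets

theorem polyTime_table : PolyTime Prepared.table := by
  have hA : PolyTime fun y : Prepared => adj y.input.G := polyTime_prepared.fst
  have hE := polyTime_unitVectors hA
  have hK := polyTime_subtreeList hA hE polyTime_prepared.snd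
  have hb : PolyTime fun y : Prepared => (subtreeList (adj y.input.G)
      (unitVectors (adj y.input.G)) y.sets).map fun S => (S, (none : Option Pairs)) :=
    PolyTime.map (f := fun _ S => (S, (none : Option Pairs))) hK (PolyTime.id.snd.pair .none)
  let N : Prepared → ℕ := fun y => sz (adj y.input.G)
  have hN : PolyBounded N := hA.size
  let M : Prepared → ℕ := fun y =>
    sz (subtreeList (adj y.input.G) (unitVectors (adj y.input.G)) y.sets)
      * ((4 * N y + 1) + (N y * N y * (8 * N y + 4) + 3) + 1 + 1) + 1
  have hM : PolyBounded M :=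
    (hK.size.mul ((((((PolyBounded.const 4).mul hN).add (.const 1)).add
      (((hN.mul hN).mul (((PolyBounded.const 8).mul hN).add (.const 4))).add (.const 3))).add
      (.const 1)).add (.const 1))).add (.const 1)
  refine PolyTime.iterate (f := fun y : Prepared => nextTable (adj y.input.G)
    (unitVectors (adj y.input.G))) hA hb
    (polyTime_nextTable (hA.comp PolyTime.id.fst) (hE.comp PolyTime.id.fst) PolyTime.id.snd) hM
    fun y j hj => ?_
  rw [length_adj] at hj
  rw [y.table_eq]
  have hn : y.input.n ≤ N y := by
    have := length_lt_sz (adj y.input.G)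
    rw [length_adj] at this
    exact this.le
  refine (sz_list_le (m := (4 * N y + 1) + (N y * N y * (8 * N y + 4) + 3) + 1)
    fun e he => ?_).trans ?_
  · obtain ⟨S, -, rfl⟩ := List.mem_map.mp he
    have h1 := sz_bits S
    have h2 := sz_entry_le y.input.isTree (subtrees y.input.G y.input.bound) hj S
    have h3 : y.input.n * y.input.n * (8 * y.input.n + 4) ≤ N y * N y * (8 * N y + 4) := by gcongr
    rw [sz_pair]
    omega
  · have h1 := length_lt_sz (subtreeList (adj y.input.G) (unitVectors (adj y.input.G)) y.sets)
    have h2 : (subtreeList (adj y.input.G) (unitVectors (adj y.input.G)) y.sets).length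
        = (subtrees y.input.G y.input.bound).length := by
      rw [unitVectors_eq_verts (length_adj _), Prepared.sets, subtreeList_bits y.input.isTree,
        List.length_map]
    rw [h2] at h1
    rw [List.length_map]
    exact Nat.add_le_add_right (Nat.mul_le_mul_right _ h1.le) 1

/-- The output of the algorithm: the table of the costs, and the labels of the whole tree. -/
noncomputable def Prepared.output (y : Prepared) :
    List (Bits × Option (List Unit)) × List Bits :=
  (costTable y.table, finalLabels (adj y.input.G) (unitVectors (adj y.input.G)) y.table)

theorem polyTime_output : PolyTime Prepared.output :=
  (polyTime_costTable polyTime_table).pair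
    (polyTime_finalLabels polyTime_prepared.fst (polyTime_unitVectors polyTime_prepared.fst)
      polyTime_table)

theorem computes_output :
    ∃ T, QuasiPoly T ∧ Computes (fun x : TreeInput => (Prepared.mk x).output) T := by
  obtain ⟨T, hT, h⟩ := computes_prepared
  obtain ⟨U, ⟨C, hU⟩, h'⟩ := polyTime_output
  have hUT : QuasiPoly fun x => U (Prepared.mk x) :=
    ((hT.add (.const 2)).pow C).mono fun x => (hU _).trans
      (Nat.pow_le_pow_left (Nat.add_le_add_right (h.1 x) 2) C)
  exact ⟨_, (hT.add hUT).add (.const 1), h'.comp h⟩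

/-- A function that is computed by a term is computed by the main function of a program. -/
theorem Computes.exists_program {α β : Type} [Enc α] [Enc β] {f : α → β} {T : α → ℕ}
    (h : Computes f T) : ∃ P : Program, ∀ a, ∃ t ≤ T a + 2, P.Runs (enc a) (enc (f a)) t := by
  obtain ⟨R, e, h⟩ := h.2 1
  refine ⟨[e] ++ R ++ [], fun a => ?_⟩
  obtain ⟨t, ht, he⟩ := h [e] [] rfl a
  exact ⟨1 + t + 1, by omega, .call (.var rfl) rfl he⟩

/-! ### The output of the algorithm -/

theorem encNat_length {δ : Type} (P : List δ) :
    encNat P.length = enc (P.map fun _ => ()) := by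
  induction P with
  | nil => rfl
  | cons x P ih => rw [List.length_cons, encNat, ih]; rfl

theorem encENat_costOf {δ : Type} (o : Option (List δ)) :
    encENat (costOf o) = enc (o.map fun P => P.map fun _ => ()) := by
  cases o with
  | none => simp [costOf, encENat]; rfl
  | some P => simp [costOf, encENat, encNat_length]

/-- The table of the dynamic program as it is read off from the computed entries. -/
noncomputable def TreeInput.table (x : TreeInput) : List (Finset (Fin x.n) × ℕ∞) :=
  (subtrees x.G x.bound).map fun S => (S, costOf (entry x.G (subtrees x.G x.bound) x.n S))

theorem Prepared.table_eq_entries (y : Prepared) :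
    y.table = (subtrees y.input.G y.input.bound).map fun S => (bits S,
      (entry y.input.G (subtrees y.input.G y.input.bound) y.input.n S).map pairBits) := by
  rw [Prepared.table, finalTable, y.table_eq, length_adj]

theorem encTable_table (x : TreeInput) :
    encTable x.table = enc (costTable (Prepared.mk x).table) := by
  rw [Prepared.table_eq_entries, costTable, List.map_map, TreeInput.table, encTable, encList_map,
    enc_map]
  congr 1
  funext S
  rw [Function.comp_apply, enc_pair, encSet_eq, encENat_costOf]
  congr 1
  cases entry x.G (subtrees x.G x.bound) x.n S with
  | none => rfl
  | some P =>
    rw [Option.map_some, Option.map_some, Option.elim_some, pairBits, List.map_map]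

theorem TreeInput.isTable (x : TreeInput) : IsTable x.G x.bound x.table := by
  have hval : ∀ S ∈ subtrees x.G x.bound,
      costOf (entry x.G (subtrees x.G x.bound) x.n S) = dp x.G x.bound S := fun S hS =>
    costOf_entry x.isTree ((Finset.card_le_univ S).trans (Fintype.card_fin _).le) hS
  refine ⟨(nodup_nub _).map fun S T h => congrArg Prod.fst h, fun S b => ?_⟩
  rw [TreeInput.table, List.mem_map, ← and_assoc, ← mem_subtrees x.isTree]
  constructor
  · rintro ⟨T, hT, h⟩
    obtain ⟨rfl, rfl⟩ := Prod.mk.inj h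
    exact ⟨hT, hval T hT⟩
  · rintro ⟨hS, rfl⟩
    exact ⟨S, hS, Prod.ext rfl (hval S hS)⟩

theorem TreeInput.dp_univ (x : TreeInput) : dp x.G x.bound Finset.univ = opt x.G Finset.univ := by
  have := dp_log_univ x.isTree
  rwa [Fintype.card_fin] at this

/-- The entry of the whole tree is an optimal labeling. -/
theorem TreeInput.exists_labels (x : TreeInput) : ∃ H : Fin x.n → Finset (Fin x.n),
    encFamily H = enc (finalLabels (adj x.G) (unitVectors (adj x.G)) (Prepared.mk x).table) ∧
      IsOptimal x.G H ∧ dp x.G x.bound Finset.univ = cost H := by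
  have huniv : Finset.univ ∈ subtrees x.G x.bound := by
    rw [mem_subtrees x.isTree, boundary_univ]
    exact ⟨isSubtree_univ x.isTree, by simp⟩
  have hcost := costOf_entry x.isTree (j := x.n) (by simp) huniv
  rw [x.dp_univ] at hcost
  have hfin : opt x.G Finset.univ ≠ ⊤ := by
    intro htop
    -- the optimum is finite, being the cost of a labeling
    have h1 : Labels x.G Finset.univ (Finset.univ : Finset (Fin x.n × Fin x.n)) := fun u _ v _ =>
      ⟨u, Finset.mem_univ _, Finset.mem_univ _, btw_left u v⟩
    have h2 := h1.opt_le x.isTree (isSubtree_univ x.isTree)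
    rw [htop] at h2
    exact absurd (top_le_iff.mp h2) (ENat.natCast_ne_top _)
  cases hP : entry x.G (subtrees x.G x.bound) x.n Finset.univ with
  | none =>
    rw [hP] at hcost
    exact absurd hcost.symm hfin
  | some P =>
    rw [hP] at hcost
    obtain ⟨h1, h2⟩ := isOptimal_labelsOf x.isTree
      (labels_entry x.isTree (isSubtree_univ x.isTree) hP) hcost
    refine ⟨labelsOf P, ?_, h1, by rw [x.dp_univ, h2]⟩
    rw [Prepared.table_eq_entries, unitVectors_eq_verts (length_adj _), encFamily_eq,
      finalLabels_bits huniv hP]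

end RunningTime

end HubLabeling

/-- There are constants `c`, `C` and one program that, on every tree `G` with `n` vertices, computes
within `n ^ O(log n)` steps the table of the dynamic program restricted to subtrees with boundary of
size at most `c * log n`, together with an optimal hub labeling, whose cost is the entry `B[G]`. -/
theorem mainTheorem6 :
    ∃ (c C : ℕ) (P : HubLabeling.Program), ∀ (n : ℕ) (G : SimpleGraph (Fin n)), G.IsTree →
      ∃ (L : List (Finset (Fin n) × ℕ∞)) (H : Fin n → Finset (Fin n)) (t : ℕ),
        P.Runs (HubLabeling.encGraph G)
          (.cons (HubLabeling.encTable L) (HubLabeling.encFamily H)) t ∧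
        t ≤ C * n ^ (C * Nat.log 2 n) ∧
        HubLabeling.IsTable G (c * Nat.log 2 n) L ∧
        HubLabeling.IsOptimal G H ∧
        HubLabeling.dp G (c * Nat.log 2 n) Finset.univ = (HubLabeling.cost H : ℕ∞) := by
  obtain ⟨T, hT, hcomp⟩ := HubLabeling.computes_output
  obtain ⟨P, hP⟩ := hcomp.exists_program
  obtain ⟨C, hC⟩ := hT.add (.const 2)
  refine ⟨19, C, P, fun n G hG => ?_⟩
  let x : HubLabeling.TreeInput := ⟨n, G, hG⟩
  obtain ⟨H, hH, hopt, hdp⟩ := x.exists_labels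
  obtain ⟨t, ht, hrun⟩ := hP x
  refine ⟨x.table, H, t, ?_, ht.trans (hC x), x.isTable, hopt, hdp⟩
  rw [HubLabeling.encTable_table, hH]
  exact hrun
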